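/- Let $G$ be a finite directed graph without loops or multiple arcs. A path decomposition of $G$ is a finite family of simple directed paths in $G$ such that every arc of $G$ lies on exactly one path of the family; the path number of $G$ is the smallest number of paths in a path decomposition of $G$. For vertices $s,t$ of a digraph $G$ with vertex set $\{0,\dots,n-1\}$, let $\langle G,s,t\rangle\in\{0,1\}^*$ be the string $1^n0\,1^s0\,1^t0\,A$, where $A$ is the adjacency matrix of $G$ written row by row. Corollary. Reachability in directed acyclic graphs of bounded path number is computable in logspace. That is, for every constant $k\in\mathbb{N}$ there is a deterministic Turing machine with a read-only input tape and finitely many work tapes which halts on every input $w\in\{0,1\}^*$ after using $O(\log |w|)$ work space (when $|w|\ge 2$; $O(1)$ otherwise), where the implied constant may depend on $k$, and such that for every $n$, every directed acyclic graph $G$ on $\{0,\dots,n-1\}$ whose path number is at most $k$, and all vertices $s,t$ of $G$, the machine accepts $\langle G,s,t\rangle$ if and only if there is a directed path (possibly of length $0$) from $s$ to $t$ in $G$. (For such inputs the space used is $O(\log n)$ for $n\ge 2$.) -/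

import Mathlib

/-! ### Directed graphs: reachability, acyclicity, path decompositions -/

/-- `t` is reachable from `s`: there is a directed path (possibly of length `0`) from `s` to `t`. -/
def Digraph.Reachable {V : Type*} (G : Digraph V) (s t : V) : Prop :=
  Relation.ReflTransGen G.Adj s t

/-- `G` has no directed cycle (in particular it has no loop). -/
def Digraph.IsAcyclic {V : Type*} (G : Digraph V) : Prop :=
  ∀ v, ¬ Relation.TransGen G.Adj v v

/-- A simple directed path of `G`, given as its nonempty list of pairwise distinct vertices. -/
structure Digraph.IsSimplePath {V : Type*} (G : Digraph V) (p : List V) : Prop where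
  ne_nil : p ≠ []
  nodup : p.Nodup
  isChain : p.IsChain G.Adj

/-- The arc `(u, v)` lies on the path `p`: `u` and `v` are consecutive vertices of `p`. -/
def ArcOn {V : Type*} (u v : V) (p : List V) : Prop :=
  [u, v] <:+: p

/-- A family of simple directed paths of `G` such that every arc of `G` lies on exactly one of
them. -/
structure Digraph.IsPathDecomposition {V : Type*} (G : Digraph V) {k : ℕ}
    (P : Fin k → List V) : Prop where
  isSimplePath : ∀ i, G.IsSimplePath (P i)
  existsUnique_arcOn : ∀ u v, G.Adj u v → ∃! i, ArcOn u v (P i)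

/-- The path number of `G`: the smallest number of paths in a path decomposition of `G`. -/
noncomputable def Digraph.pathNumber {V : Type*} (G : Digraph V) : ℕ :=
  sInf {k | ∃ P : Fin k → List V, G.IsPathDecomposition P}

/-- A finite digraph without loops has a path decomposition. -/
theorem Digraph.exists_isPathDecomposition {V : Type*} [Finite V] (G : Digraph V)
    (h : ∀ v, ¬ G.Adj v v) : ∃ (k : ℕ) (P : Fin k → List V), G.IsPathDecomposition P := by
  have hpair : ∀ a b c d : V, [a, b] <:+: [c, d] ↔ a = c ∧ b = d := by
    intro a b c d
    constructor
    · intro hi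
      have := hi.eq_of_length rfl
      simpa using this
    · rintro ⟨rfl, rfl⟩
      exact List.infix_refl _
  have hfin : Finite {e : V × V // G.Adj e.1 e.2} := inferInstance
  obtain ⟨k, ⟨f⟩⟩ := Finite.exists_equiv_fin {e : V × V // G.Adj e.1 e.2}
  refine ⟨k, fun i => [(f.symm i).1.1, (f.symm i).1.2], ?_, ?_⟩
  · intro i
    refine ⟨by simp, ?_, ?_⟩
    · have hi := (f.symm i).2
      have hne : (f.symm i).1.1 ≠ (f.symm i).1.2 := by
        intro he
        rw [← he] at hi
        exact h _ hi
      simpa using hne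
    · simpa using (f.symm i).2
  · intro u v huv
    refine ⟨f ⟨(u, v), huv⟩, ?_, ?_⟩
    · simp [ArcOn]
    · intro i hi
      have hi' := (hpair _ _ _ _).1 hi
      rw [← Equiv.symm_apply_eq]
      exact Subtype.ext (Prod.ext hi'.1.symm hi'.2.symm)

/-- On finite digraphs without loops the path number is attained. -/
theorem Digraph.exists_isPathDecomposition_pathNumber {V : Type*} [Finite V] (G : Digraph V)
    (h : ∀ v, ¬ G.Adj v v) : ∃ P : Fin G.pathNumber → List V, G.IsPathDecomposition P :=
  Nat.sInf_mem (s := {k | ∃ P : Fin k → List V, G.IsPathDecomposition P})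
    (G.exists_isPathDecomposition h)

/-! ### Encoding of instances -/

open Classical in
/-- The binary string `⟨G, s, t⟩ = 1ⁿ 0 1ˢ 0 1ᵗ 0 A`, where the vertices are `0, …, n - 1` and `A`
is the adjacency matrix of `G` (`n * n` bits, row by row). -/
noncomputable def encodeInstance {n : ℕ} (G : Digraph (Fin n)) (s t : Fin n) : List Bool :=
  List.replicate n true ++ false :: (List.replicate (s : ℕ) true ++ false ::
    (List.replicate (t : ℕ) true ++ false ::
      (List.finRange n).flatMap fun u => (List.finRange n).map fun v => decide (G.Adj u v)))

/-! ### Deterministic Turing machines with a read-only input tape, and logarithmic space -/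

/-- The contents of a cell of the input tape: a bit or one of the two end markers. -/
inductive InputSymbol where
  | leftEnd
  | bit (b : Bool)
  | rightEnd

/-- Head moves. -/
inductive HeadMove where
  | left
  | stay
  | right

/-- New position of a head on a one-way infinite tape with cells `0, 1, 2, …`
(in cell `0` the move to the left has no effect). -/
def HeadMove.apply : HeadMove → ℕ → ℕ
  | left, p => p - 1
  | stay, p => p
  | right, p => p + 1

/-- A deterministic Turing machine with a two-way read-only input tape and finitely many one-way
infinite read-write work tapes. `verdict q` is `none` if `q` is not a halting state, and otherwise
tells whether the machine accepts (`some true`) or rejects (`some false`) in `q`. -/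
structure OfflineTM where
  State : Type
  Symbol : Type
  finite_state : Finite State
  finite_symbol : Finite Symbol
  blank : Symbol
  numTapes : ℕ
  start : State
  verdict : State → Option Bool
  /-- From the state and the scanned symbols: the new state, the move of the input head, and for
  each work tape the symbol to write and the move of its head. -/
  transition : State → InputSymbol → (Fin numTapes → Symbol) →
    State × HeadMove × (Fin numTapes → Symbol × HeadMove)

namespace OfflineTM

/-- Configurations. -/
structure Cfg (M : OfflineTM) where
  state : M.State
  inputPos : ℕ
  tape : Fin M.numTapes → ℕ → M.Symbol
  pos : Fin M.numTapes → ℕ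

/-- The input tape carries `w` in cells `1, …, |w|`, between the end markers in cells `0` and
`|w| + 1`. -/
def inputAt (w : List Bool) : ℕ → InputSymbol
  | 0 => .leftEnd
  | p + 1 => (w[p]?).elim .rightEnd .bit

/-- The initial configuration: blank work tapes, all heads in cell `0`. -/
def initial (M : OfflineTM) : M.Cfg where
  state := M.start
  inputPos := 0
  tape := fun _ _ => M.blank
  pos := fun _ => 0

/-- One step on input `w`; halting configurations do not change. The input head never moves beyond
the right end marker. -/
def step (M : OfflineTM) (w : List Bool) (c : M.Cfg) : M.Cfg :=
  match M.verdict c.state with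
  | some _ => c
  | none =>
    let r := M.transition c.state (inputAt w c.inputPos) (fun i => c.tape i (c.pos i))
    { state := r.1
      inputPos := min (r.2.1.apply c.inputPos) (w.length + 1)
      tape := fun i => Function.update (c.tape i) (c.pos i) (r.2.2 i).1
      pos := fun i => (r.2.2 i).2.apply (c.pos i) }

/-- The configuration after `m` steps on input `w`. -/
def run (M : OfflineTM) (w : List Bool) (m : ℕ) : M.Cfg :=
  (M.step w)^[m] M.initial

/-- On input `w` the machine halts with answer `b`. -/
def Outputs (M : OfflineTM) (w : List Bool) (b : Bool) : Prop :=
  ∃ m, M.verdict (M.run w m).state = some b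

/-- On input `w` the machine visits at most the first `S` cells of each work tape. -/
def UsesSpace (M : OfflineTM) (w : List Bool) (S : ℕ) : Prop :=
  ∀ m i, (M.run w m).pos i < S

/-- `M` decides the language `A`: it halts on every input, accepting exactly the words of `A`. -/
def Decides (M : OfflineTM) (A : Language Bool) : Prop :=
  ∀ w, (w ∈ A → M.Outputs w true) ∧ (w ∉ A → M.Outputs w false)

end OfflineTM

/-- The class `L`: languages decided by a deterministic Turing machine which uses
`O(log |w|)` work space on every input `w`. -/
def InLogspace (A : Language Bool) : Prop :=
  ∃ (M : OfflineTM) (c : ℕ), M.Decides A ∧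
    ∀ w : List Bool, M.UsesSpace w (c * (Nat.log 2 w.length + 1))

/-! A decomposition into at most `k` paths is never computed. It only yields that all indegrees and
outdegrees are at most `k`, and that the sum over all vertices of outdegree minus indegree,
truncated at zero, is at most `k` (`sum_excess_le`, `IsAcyclic.boundedExcess`). At each vertex the
incoming arc of rank `i` is linked to the outgoing arc of rank `i`. Each arc then has at most one
successor, and by acyclicity the chains starting at unlinked arcs cover all arcs (`exists_root`).
There are at most `k` such chains (`card_roots_le`).

Given a walk from `s` to `t`, one can jump along the chain of its first arc to the last arc of the
walk on that chain; the rest of the walk is covered by the other chains. So at most `k` jumps lead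
to `t` (`alongPow_of_arcFrom`). Conversely, every jump follows a walk of the graph.

The space bound comes from machines whose only storage is a fixed number of binary counters bounded
by the input length. The predicates they test are closed under Boolean operations, bounded
quantification and iteration of a least-successor relation (`LS.pow`). Iteration gives addition,
multiplication, hence access to the adjacency matrix, and the traversal of a chain; the `k` jumps
become a constant number of nested quantifiers. -/

/-! ### Machine components with boolean exits -/

/-- Symbols on the work tapes: `none` marks the left end, `some none` is the blank, and
`some (some b)` is a bit. -/
abbrev TapeSymbol := Option (Option Bool)

/-- A fragment of a machine with `T` work tapes; it is left with a boolean answer. -/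
structure Component (T : ℕ) where
  State : Type
  finite_state : Finite State
  start : State
  trans : State → InputSymbol → (Fin T → TapeSymbol) →
    (State ⊕ Bool) × HeadMove × (Fin T → TapeSymbol × HeadMove)

/-- The data of a configuration apart from the state. -/
@[ext]
structure Memory (T : ℕ) where
  inputPos : ℕ
  tape : Fin T → ℕ → TapeSymbol
  pos : Fin T → ℕ

namespace Memory

variable {T : ℕ}

/-- The scanned work tape symbols. -/
def scan (d : Memory T) : Fin T → TapeSymbol := fun i => d.tape i (d.pos i)

/-- Writing and moving the heads. -/
def act (w : List Bool) (d : Memory T) (a : HeadMove × (Fin T → TapeSymbol × HeadMove)) :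
    Memory T where
  inputPos := min (a.1.apply d.inputPos) (w.length + 1)
  tape := fun i => Function.update (d.tape i) (d.pos i) (a.2 i).1
  pos := fun i => (a.2 i).2.apply (d.pos i)

end Memory

namespace Component

variable {T : ℕ}

/-- From state `q` and memory `d` the component exits with answer `b` and memory `d'`, and all heads
stay in the first `S` cells. -/
inductive Run (C : Component T) (w : List Bool) (S : ℕ) :
    C.State → Memory T → Bool → Memory T → Prop
  | exit {q d b a} (hd : ∀ i, d.pos i < S)
      (h : C.trans q (OfflineTM.inputAt w d.inputPos) d.scan = (Sum.inr b, a))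
      (hd' : ∀ i, (d.act w a).pos i < S) : Run C w S q d b (d.act w a)
  | next {q d q' a b d'} (hd : ∀ i, d.pos i < S)
      (h : C.trans q (OfflineTM.inputAt w d.inputPos) d.scan = (Sum.inl q', a))
      (hr : Run C w S q' (d.act w a) b d') : Run C w S q d b d'

/-- Run `C`, then `P` or `Q` according to the answer. -/
def cond (C P Q : Component T) : Component T where
  State := C.State ⊕ P.State ⊕ Q.State
  finite_state := by
    have := C.finite_state
    have := P.finite_state
    have := Q.finite_state
    infer_instance
  start := Sum.inl C.start
  trans
    | Sum.inl q, s, c =>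
      ((C.trans q s c).1.elim (fun q' => Sum.inl (Sum.inl q'))
        (fun b => Sum.inl (Sum.inr (bif b then Sum.inl P.start else Sum.inr Q.start))),
        (C.trans q s c).2)
    | Sum.inr (Sum.inl q), s, c =>
      ((P.trans q s c).1.map (fun q' => Sum.inr (Sum.inl q')) id, (P.trans q s c).2)
    | Sum.inr (Sum.inr q), s, c =>
      ((Q.trans q s c).1.map (fun q' => Sum.inr (Sum.inr q')) id, (Q.trans q s c).2)

/-- Run `C` again and again as long as the answer is `true`. -/
def loop (C : Component T) : Component T where
  State := C.State
  finite_state := C.finite_state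
  start := C.start
  trans q s c :=
    ((C.trans q s c).1.elim Sum.inl (fun b => bif b then Sum.inl C.start else Sum.inr true),
      (C.trans q s c).2)

variable {C P Q : Component T} {w : List Bool} {S : ℕ} {d d' d'' : Memory T} {b b' : Bool}

/-- The answer is a variable with an equation, because the induction on the run needs a free index.
-/
theorem Run.cond_true {q : C.State} (h : C.Run w S q d b d') (hb : b = true)
    (hP : P.Run w S P.start d' b' d'') : (cond C P Q).Run w S (Sum.inl q) d b' d'' := by
  have key : ∀ {q d b' d''}, P.Run w S q d b' d'' →
      (cond C P Q).Run w S (Sum.inr (Sum.inl q)) d b' d'' := by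
    intro q d b' d'' h
    induction h with
    | exit hd h hd' => exact .exit hd (by simp [cond, h]) hd'
    | next hd h _ ih => exact .next hd (by simp [cond, h]) ih
  induction h with
  | exit hd h hd' =>
    subst hb
    exact .next hd (by simp [cond, h]) (key hP)
  | next hd h _ ih => exact .next hd (by simp [cond, h]) (ih hb hP)

theorem Run.cond_false {q : C.State} (h : C.Run w S q d b d') (hb : b = false)
    (hQ : Q.Run w S Q.start d' b' d'') : (cond C P Q).Run w S (Sum.inl q) d b' d'' := by
  have key : ∀ {q d b' d''}, Q.Run w S q d b' d'' →
      (cond C P Q).Run w S (Sum.inr (Sum.inr q)) d b' d'' := by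
    intro q d b' d'' h
    induction h with
    | exit hd h hd' => exact .exit hd (by simp [cond, h]) hd'
    | next hd h _ ih => exact .next hd (by simp [cond, h]) ih
  induction h with
  | exit hd h hd' =>
    subst hb
    exact .next hd (by simp [cond, h]) (key hQ)
  | next hd h _ ih => exact .next hd (by simp [cond, h]) (ih hb hQ)

theorem Run.loop_false {q : C.State} (h : C.Run w S q d b d') (hb : b = false) :
    (loop C).Run w S q d true d' := by
  induction h with
  | exit hd h hd' =>
    subst hb
    exact .exit hd (by simp [loop, h]) hd'
  | next hd h _ ih => exact .next hd (by simp [loop, h]) (ih hb)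

theorem Run.loop_true {q : C.State} (h : C.Run w S q d b d') (hb : b = true)
    (hl : (loop C).Run w S C.start d' b' d'') : (loop C).Run w S q d b' d'' := by
  induction h with
  | exit hd h hd' =>
    subst hb
    exact .next hd (by simp [loop, h]) hl
  | next hd h _ ih => exact .next hd (by simp [loop, h]) (ih hb hl)

/-- The Turing machine of a component. -/
def toTM (C : Component T) : OfflineTM where
  State := C.State ⊕ Bool
  Symbol := TapeSymbol
  finite_state := by
    have := C.finite_state
    infer_instance
  finite_symbol := inferInstance
  blank := some none
  numTapes := T
  start := Sum.inl C.start
  verdict := Sum.elim (fun _ => none) some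
  transition
    | Sum.inl q, s, c => C.trans q s c
    | Sum.inr b, _, c => (Sum.inr b, .stay, fun i => (c i, .stay))

/-- The configuration of `C.toTM` with given state and memory. -/
def cfg (C : Component T) (q : C.State ⊕ Bool) (d : Memory T) : C.toTM.Cfg :=
  { state := q, inputPos := d.inputPos, tape := d.tape, pos := d.pos }

theorem step_cfg {q : C.State} {r : C.State ⊕ Bool} {a}
    (h : C.trans q (OfflineTM.inputAt w d.inputPos) d.scan = (r, a)) :
    C.toTM.step w (cfg C (Sum.inl q) d) = cfg C r (d.act w a) := by
  have h' : C.toTM.transition (Sum.inl q) (OfflineTM.inputAt w d.inputPos)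
    (fun i => d.tape i (d.pos i)) = (r, a) := h
  have hv : C.toTM.verdict (Sum.inl q) = none := rfl
  simp only [OfflineTM.step, cfg, hv, h']
  rfl

theorem step_cfg_inr : C.toTM.step w (cfg C (Sum.inr b) d) = cfg C (Sum.inr b) d := rfl

/-- Halting configurations are fixed by `step`, so the space bound along the finite run holds at all
times. -/
theorem Run.toTM {q : C.State} (h : C.Run w S q d b d') :
    (∃ m, (C.toTM.step w)^[m] (cfg C (Sum.inl q) d) = cfg C (Sum.inr b) d') ∧
      ∀ m i, ((C.toTM.step w)^[m] (cfg C (Sum.inl q) d)).pos i < S := by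
  induction h with
  | @exit q d b a hd h hd' =>
    have hs := step_cfg (w := w) h
    refine ⟨⟨1, hs⟩, fun m i => ?_⟩
    rcases m with _ | m
    · exact hd i
    · rw [Function.iterate_succ_apply, hs, Function.iterate_fixed step_cfg_inr]
      exact hd' i
  | @next q d q' a b d' hd h _ ih =>
    have hs := step_cfg (w := w) h
    obtain ⟨⟨m, hm⟩, hb⟩ := ih
    refine ⟨⟨m + 1, by rw [Function.iterate_succ_apply, hs, hm]⟩, fun m i => ?_⟩
    rcases m with _ | m
    · exact hd i
    · rw [Function.iterate_succ_apply, hs]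
      exact hb m i

/-- One step: an answer depending on the input symbol, a move on the input tape, and the same
writing on all work tapes. -/
def atom (f : InputSymbol → Bool) (h : HeadMove) (g : TapeSymbol → TapeSymbol) : Component T where
  State := Unit
  finite_state := inferInstance
  start := ()
  trans _ s c := (Sum.inr (f s), h, fun i => (g (c i), .stay))

theorem Run.atom {f h} {g : TapeSymbol → TapeSymbol} (hd : ∀ i, d.pos i < S) :
    (atom f h g).Run w S () d (f (OfflineTM.inputAt w d.inputPos))
      { inputPos := min (h.apply d.inputPos) (w.length + 1)
        tape := fun i => Function.update (d.tape i) (d.pos i) (g (d.tape i (d.pos i)))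
        pos := d.pos } :=
  Run.exit (C := Component.atom f h g) (a := (h, fun i => (g (d.scan i), .stay))) hd rfl hd

end Component

/-! ### Lockstep sweeps over the work tapes -/

namespace Memory

variable {T : ℕ}

/-- All heads in cell `p`, marker in cell `0`, and `f` from cell `1` on. -/
def ofCells (ip : ℕ) (f : Fin T → ℕ → Option Bool) (p : ℕ) : Memory T where
  inputPos := ip
  tape := fun i j => j.casesOn none fun j => some (f i j)
  pos := fun _ => p

end Memory

namespace Component

variable {T : ℕ}

theorem Run.exit_of_eq {C : Component T} {w : List Bool} {S : ℕ} {d d' : Memory T} {b : Bool}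
    {q : C.State} {a} (hd : ∀ i, d.pos i < S)
    (h : C.trans q (OfflineTM.inputAt w d.inputPos) d.scan = (Sum.inr b, a))
    (ha : d.act w a = d') (hd' : ∀ i, d'.pos i < S) : Run C w S q d b d' := by
  subst ha
  exact .exit hd h hd'

theorem Run.next_of_eq {C : Component T} {w : List Bool} {S : ℕ} {d d₁ d' : Memory T} {b : Bool}
    {q q' : C.State} {a} (hd : ∀ i, d.pos i < S)
    (h : C.trans q (OfflineTM.inputAt w d.inputPos) d.scan = (Sum.inl q', a))
    (ha : d.act w a = d₁) (hr : Run C w S q' d₁ b d') : Run C w S q d b d' := by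
  subst ha
  exact .next hd h hr

open Classical in
/-- All heads move in lockstep to the right, up to the first column of blanks, and back; the columns
are rewritten by the transducer `δ`. -/
noncomputable def sweep {Q : Type} [Finite Q] (T : ℕ) (q₀ : Q)
    (δ : Q → (Fin T → Option Bool) → Q × (Fin T → Option Bool)) (out : Q → Bool) :
    Component T where
  State := Option (Q ⊕ Q)
  finite_state := inferInstance
  start := none
  trans
    | none, _, c => (Sum.inl (some (Sum.inl q₀)), .stay, fun i => (c i, .right))
    | some (Sum.inl q), _, c =>
      (Sum.inl (some (if ∀ i, (c i).join = none then Sum.inr (δ q fun i => (c i).join).1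
        else Sum.inl (δ q fun i => (c i).join).1)), .stay,
        fun i => (some ((δ q fun i => (c i).join).2 i),
          if ∀ i, (c i).join = none then .left else .right))
    | some (Sum.inr q), _, c =>
      if ∀ i, c i = none then (Sum.inr (out q), .stay, fun i => (c i, .stay))
      else (Sum.inl (some (Sum.inr q)), .stay, fun i => (c i, .left))

section sweep

variable [NeZero T] {Q : Type} [Finite Q] {q₀ : Q}
  {δ : Q → (Fin T → Option Bool) → Q × (Fin T → Option Bool)} {out : Q → Bool}
  {w : List Bool} {S ip : ℕ}

/-- The way back leaves every column unchanged and stops at the marker, which only cell `0` carries.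
-/
theorem sweep_back (hip : ip ≤ w.length + 1) (f : Fin T → ℕ → Option Bool) (q : Q) (p : ℕ)
    (hp : p < S) :
    (sweep T q₀ δ out).Run w S (some (Sum.inr q)) (.ofCells ip f p) (out q) (.ofCells ip f 0) := by
  induction p with
  | zero =>
    refine Run.exit_of_eq (a := (.stay, fun i => (none, .stay))) (fun _ => hp) ?_ ?_ (fun _ => hp)
    · simp [sweep, Memory.scan, Memory.ofCells]
    · ext i j
      · simp [Memory.act, Memory.ofCells, HeadMove.apply, hip]
      · simp only [Memory.act, Memory.ofCells, Function.update_apply]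
        split_ifs with h
        · simp [h]
        · rfl
      · rfl
  | succ p ih =>
    refine Run.next_of_eq (q' := (some (Sum.inr q) : Option (Q ⊕ Q)))
      (a := (.stay, fun i => (some (f i p), .left))) (fun _ => hp) ?_ ?_ (ih (by omega))
    · simp [sweep, Memory.scan, Memory.ofCells]
    · ext i j
      · simp [Memory.act, Memory.ofCells, HeadMove.apply, hip]
      · simp only [Memory.act, Memory.ofCells, Function.update_apply]
        split_ifs with h
        · simp [h]
        · rfl
      · rfl

/-- Here `L` is the first column that is blank on all tapes. The transducer also processes that
column, so a carry can be written there and a number can grow by one digit. -/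
theorem sweep_run (hip : ip ≤ w.length + 1) {f f' : Fin T → ℕ → Option Bool} {L : ℕ}
    (hL : ∀ i, f i L = none) (hL' : ∀ p < L, ∃ i, f i p ≠ none) (qs : ℕ → Q) (h0 : qs 0 = q₀)
    (hqs : ∀ p ≤ L, δ (qs p) (fun i => f i p) = (qs (p + 1), fun i => f' i p))
    (hf : ∀ p, L < p → ∀ i, f' i p = f i p) (hS : L + 1 < S) :
    (sweep T q₀ δ out).Run w S (sweep T q₀ δ out).start (.ofCells ip f 0) (out (qs (L + 1)))
      (.ofCells ip f' 0) := by
  -- Invariant on the way out: the columns before `p` are rewritten, the others are still old. The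
  -- head is in cell `p + 1`, as cell `0` holds the marker.
  have key : ∀ m p, p + m = L → (sweep T q₀ δ out).Run w S (some (Sum.inl (qs p)))
      (.ofCells ip (fun i j => if j < p then f' i j else f i j) (p + 1)) (out (qs (L + 1)))
      (.ofCells ip f' 0) := by
    intro m
    induction m with
    | zero =>
      rintro p rfl
      refine Run.next_of_eq (q' := (some (Sum.inr (qs (p + 1))) : Option (Q ⊕ Q)))
        (a := (.stay, fun i => (some (f' i p), .left))) (fun _ => hS) ?_ ?_
        (sweep_back hip f' _ p (by omega))
      · have hδ := hqs p le_rfl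
        have hn : ∀ i, f i p = none := hL
        simp only [hn] at hδ
        simp [sweep, Memory.scan, Memory.ofCells, hn, hδ]
      · ext i j
        · simp [Memory.act, Memory.ofCells, HeadMove.apply, hip]
        · rcases j with _ | j
          · simp [Memory.act, Memory.ofCells]
          · rcases lt_trichotomy j p with h | h | h
            · simp [Memory.act, Memory.ofCells, h.ne, h]
            · simp [Memory.act, Memory.ofCells, h]
            · simp [Memory.act, Memory.ofCells, h.ne', h.not_gt,
                hf j (by simpa using h) i]
        · rfl
    | succ m ih =>
      intro p hp
      refine Run.next_of_eq (q' := (some (Sum.inl (qs (p + 1))) : Option (Q ⊕ Q)))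
        (a := (.stay, fun i => (some (f' i p), .right)))
        (fun _ => show p + 1 < S by omega) ?_ ?_ (ih (p + 1) (by omega))
      · have hδ := hqs p (by omega)
        obtain ⟨i, hi⟩ := hL' p (by omega)
        have hn : ¬ ∀ i, f i p = none := fun h => hi (h i)
        simp [sweep, Memory.scan, Memory.ofCells, hn, hδ]
      · ext i j
        · simp [Memory.act, Memory.ofCells, HeadMove.apply, hip]
        · rcases j with _ | j
          · simp [Memory.act, Memory.ofCells]
          · rcases lt_trichotomy j p with h | h | h
            · simp [Memory.act, Memory.ofCells, h.ne, h, h.le]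
            · simp [Memory.act, Memory.ofCells, h]
            · simp [Memory.act, Memory.ofCells, h.ne', h.not_gt, h.not_ge]
        · rfl
  refine Run.next_of_eq (q' := (some (Sum.inl (qs 0)) : Option (Q ⊕ Q)))
    (a := (.stay, fun i => (none, .right))) (fun _ => show 0 < S by omega) ?_ ?_
    (key L 0 (by omega))
  · simp [sweep, Memory.scan, Memory.ofCells, h0]
  · ext i j
    · simp [Memory.act, Memory.ofCells, HeadMove.apply, hip]
    · rcases j with _ | j <;> simp [Memory.act, Memory.ofCells]
    · rfl

end sweep

/-! ### Counters -/

/-- The memory in which tape `i` holds the number `v i`. -/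
def store (T ip : ℕ) (v : ℕ → ℕ) : Memory T :=
  .ofCells ip (fun i j => (Nat.bits (v i))[j]?) 0

/-- The space bound. -/
def space (w : List Bool) : ℕ := Nat.size w.length + 3

/-- `C` leads from the counter values `v` to the counter values `v'`. -/
def Does (C : Component T) (w : List Bool) (ip : ℕ) (v : ℕ → ℕ) (b : Bool) (ip' : ℕ)
    (v' : ℕ → ℕ) : Prop :=
  C.Run w (space w) C.start (store T ip v) b (store T ip' v')

section ops

variable [NeZero T] {w : List Bool} {ip : ℕ} {v : ℕ → ℕ}

theorem bits_getElem?_eq_none {a l j : ℕ} (h : a ≤ l) (hj : Nat.size l ≤ j) :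
    (Nat.bits a)[j]? = none := by
  rw [List.getElem?_eq_none_iff, Nat.size_eq_bits_len]
  exact (Nat.size_le_size h).trans hj

/-- The last two hypotheses range over every common length bound `L`, so that the column where the
sweep turns need not be known to the user. -/
theorem does_sweep {Q : Type} [Finite Q] {q₀ : Q}
    {δ : Q → (Fin T → Option Bool) → Q × (Fin T → Option Bool)} {out : Q → Bool}
    (hip : ip ≤ w.length + 1) (hv : ∀ i, v i ≤ w.length) {v' : ℕ → ℕ} (qs : ℕ → Q)
    (h0 : qs 0 = q₀) {b : Bool}
    (hqs : ∀ p, δ (qs p) (fun i => (Nat.bits (v i))[p]?) =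
      (qs (p + 1), fun i : Fin T => (Nat.bits (v' i))[p]?))
    (hv' : ∀ L, (∀ i : Fin T, (Nat.bits (v i)).length ≤ L) →
      ∀ i : Fin T, (Nat.bits (v' i)).length ≤ L + 1)
    (hb : ∀ L, (∀ i : Fin T, (Nat.bits (v i)).length ≤ L) → out (qs (L + 1)) = b) :
    (sweep T q₀ δ out).Does w ip v b ip v' := by
  classical
  have hex : ∃ L, ∀ i : Fin T, (Nat.bits (v i))[L]? = none :=
    ⟨_, fun i => bits_getElem?_eq_none (hv i) le_rfl⟩
  have hlen : ∀ i : Fin T, (Nat.bits (v i)).length ≤ Nat.find hex := fun i => by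
    simpa using Nat.find_spec hex i
  have hle : Nat.find hex ≤ Nat.size w.length :=
    Nat.find_min' hex fun i => bits_getElem?_eq_none (hv i) le_rfl
  rw [← hb _ hlen]
  refine sweep_run hip (L := Nat.find hex) (Nat.find_spec hex) (fun p hp => ?_) qs h0
    -- Beyond the turning column both the old and the new numbers have run out of digits.
    (fun p _ => hqs p) (fun p hp i => ?_) (by unfold space; omega)
  · simpa using Nat.find_min hex hp
  · have h1 := hv' _ hlen i
    have h2 := hlen i
    rw [List.getElem?_eq_none (by omega), List.getElem?_eq_none (by omega)]

/-- `x := 0`. -/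
noncomputable def clear (T x : ℕ) : Component T :=
  sweep T () (fun _ c => ((), fun i => if (i : ℕ) = x then none else c i)) fun _ => true

/-- `y := x`. -/
noncomputable def copy (x : Fin T) (y : ℕ) : Component T :=
  sweep T () (fun _ c => ((), fun i => if (i : ℕ) = y then c x else c i)) fun _ => true

/-- Test for `x = y`. -/
noncomputable def eq (x y : Fin T) : Component T :=
  sweep T true (fun q c => (q && c x == c y, c)) id

/-- `x := x + 1`. -/
noncomputable def inc (x : Fin T) : Component T :=
  sweep T true (fun q c => (q && c x == some true, fun i => if i = x then
    bif q then some (c x != some true) else c i else c i)) fun _ => true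

theorem does_clear {x : ℕ} (hip : ip ≤ w.length + 1) (hv : ∀ i, v i ≤ w.length) :
    (clear T x).Does w ip v true ip (Function.update v x 0) := by
  refine does_sweep hip hv (fun _ => ()) rfl (fun p => ?_) (fun L hL i => ?_) fun _ _ => rfl
  · ext i : 2
    · by_cases h : (i : ℕ) = x <;> simp [h]
  · by_cases h : (i : ℕ) = x
    · simp [h]
    · simpa [h] using (hL i).trans (Nat.le_succ L)

theorem does_copy {x : Fin T} {y : ℕ} (hip : ip ≤ w.length + 1) (hv : ∀ i, v i ≤ w.length) :
    (copy x y).Does w ip v true ip (Function.update v y (v x)) := by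
  refine does_sweep hip hv (fun _ => ()) rfl (fun p => ?_) (fun L hL i => ?_) fun _ _ => rfl
  · ext i : 2
    · by_cases h : (i : ℕ) = y <;> simp [h]
  · by_cases h : (i : ℕ) = y
    · simpa [h] using (hL x).trans (Nat.le_succ L)
    · simpa [h] using (hL i).trans (Nat.le_succ L)

theorem bits_injective {a b : ℕ} (h : Nat.bits a = Nat.bits b) : a = b := by
  refine Nat.eq_of_testBit_eq fun i => ?_
  rw [Nat.testBit_eq_inth, Nat.testBit_eq_inth, h]

/-- The state records whether all columns so far agree. Blanks are compared too, so numbers of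
different lengths are told apart. -/
theorem does_eq {x y : Fin T} (hip : ip ≤ w.length + 1) (hv : ∀ i, v i ≤ w.length) :
    (eq x y).Does w ip v (decide (v x = v y)) ip v := by
  refine does_sweep hip hv
    (fun p => decide (∀ j < p, (Nat.bits (v x))[j]? = (Nat.bits (v y))[j]?)) (by simp)
    (fun p => ?_) (fun L hL i => (hL i).trans (Nat.le_succ L)) fun L hL => ?_
  · ext i : 2
    · simp only [Nat.forall_lt_succ_right]
      simp [Bool.beq_eq_decide_eq]
    · rfl
  · simp only [id, decide_eq_decide]
    refine ⟨fun h => bits_injective (List.ext_getElem? fun j => ?_), fun h => by simp [h]⟩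
    by_cases hj : j < L + 1
    · exact h j hj
    · have := hL x
      have := hL y
      rw [List.getElem?_eq_none (by omega), List.getElem?_eq_none (by omega)]

/-- Binary increment. -/
def incBits : List Bool → List Bool
  | [] => [true]
  | false :: l => true :: l
  | true :: l => false :: incBits l

theorem bits_succ (a : ℕ) : Nat.bits (a + 1) = incBits (Nat.bits a) := by
  induction a using Nat.strong_induction_on with
  | _ a ih =>
    rcases Nat.even_or_odd' a with ⟨c, rfl | rfl⟩
    · rw [Nat.bit1_bits]
      rcases Nat.eq_zero_or_pos c with rfl | hc
      · rfl
      · rw [Nat.bit0_bits c hc.ne']; rfl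
    · rw [Nat.bit1_bits, show 2 * c + 1 + 1 = 2 * (c + 1) by ring, Nat.bit0_bits _ (by omega),
        ih c (by omega)]
      rfl

theorem length_incBits (l : List Bool) : (incBits l).length ≤ l.length + 1 := by
  induction l with
  | nil => simp [incBits]
  | cons b l ih => cases b <;> simp [incBits]; omega

/-- A digit flips exactly when all lower digits are `1`. The first blank counts as a `0`, which
yields the new leading digit. -/
theorem incBits_getElem? (l : List Bool) (p : ℕ) :
    (incBits l)[p]? = bif decide (∀ j < p, l[j]? = some true) then some (l[p]? != some true)
      else l[p]? := by
  induction l generalizing p with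
  | nil =>
    rcases p with _ | p
    · simp [incBits]
    · simp only [Nat.forall_lt_succ_left]
      simp [incBits]
  | cons b l ih =>
    rcases p with _ | p
    · cases b <;> simp [incBits]
    · cases b
      · simp only [Nat.forall_lt_succ_left]
        simp [incBits]
      · simp only [Nat.forall_lt_succ_left]
        simp [incBits, ih p]

theorem does_inc {x : Fin T} (hip : ip ≤ w.length + 1) (hv : ∀ i, v i ≤ w.length) :
    (inc x).Does w ip v true ip (Function.update v x (v x + 1)) := by
  refine does_sweep hip hv (fun p => decide (∀ j < p, (Nat.bits (v x))[j]? = some true)) (by simp)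
    (fun p => ?_) (fun L hL i => ?_) fun _ _ => rfl
  · ext i : 2
    · simp only [Nat.forall_lt_succ_right]
      simp [Bool.beq_eq_decide_eq]
    · by_cases h : i = x
      · subst h
        simp [bits_succ, incBits_getElem?]
      · have h' : (i : ℕ) ≠ x := fun e => h (Fin.ext e)
        simp [h, h']
  · by_cases h : i = x
    · subst h
      have := length_incBits (Nat.bits (v i))
      have := hL i
      simp [bits_succ]
      omega
    · have h' : (i : ℕ) ≠ x := fun e => h (Fin.ext e)
      simpa [h'] using (hL i).trans (Nat.le_succ L)

end ops

end Component

/-! ### Composing counter programs; reading the input; searching -/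

namespace Component

variable {T : ℕ} {C P Q : Component T} {w : List Bool} {ip ip' ip'' : ℕ} {v v' v'' : ℕ → ℕ}
  {b b' : Bool}

theorem Does.cond_true (h : C.Does w ip v true ip' v') (hP : P.Does w ip' v' b ip'' v'') :
    (cond C P Q).Does w ip v b ip'' v'' :=
  Run.cond_true h rfl hP

theorem Does.cond_false (h : C.Does w ip v false ip' v') (hQ : Q.Does w ip' v' b ip'' v'') :
    (cond C P Q).Does w ip v b ip'' v'' :=
  Run.cond_false h rfl hQ

theorem Does.loop_false (h : C.Does w ip v false ip' v') : (loop C).Does w ip v true ip' v' :=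
  Run.loop_false h rfl

theorem Does.loop_true (h : C.Does w ip v true ip' v') (hl : (loop C).Does w ip' v' b ip'' v'') :
    (loop C).Does w ip v b ip'' v'' :=
  Run.loop_true h rfl hl

/-- Run `C`, then `P`. -/
def seq (C P : Component T) : Component T := cond C P P

theorem Does.seq (h : C.Does w ip v b ip' v') (hP : P.Does w ip' v' b' ip'' v'') :
    (seq C P).Does w ip v b' ip'' v'' := by
  cases b
  · exact h.cond_false hP
  · exact h.cond_true hP

/-- A move on the input tape, with an answer depending on the scanned input symbol. -/
def input (T : ℕ) (f : InputSymbol → Bool) (h : HeadMove) : Component T := atom f h id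

/-- Do nothing, and answer `b`. -/
def skip (T : ℕ) (b : Bool) : Component T := input T (fun _ => b) .stay

theorem does_input (T : ℕ) {f h} : (input T f h).Does w ip v (f (OfflineTM.inputAt w ip))
    (min (h.apply ip) (w.length + 1)) v := by
  have := Run.atom (d := store T ip v) (w := w) (S := space w) (f := f) (h := h) (g := id)
    (fun _ => show 0 < space w by unfold space; omega)
  simp only [id, Function.update_eq_self] at this
  exact this

theorem does_skip (T : ℕ) (hip : ip ≤ w.length + 1) : (skip T b).Does w ip v b ip v := by
  have := does_input T (w := w) (ip := ip) (v := v) (f := fun _ => b) (h := .stay)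
  rwa [show HeadMove.apply .stay ip = ip from rfl, min_eq_left hip] at this

/-- Whether a symbol is not the left end marker. -/
def notLeftEnd : InputSymbol → Bool
  | .leftEnd => false
  | _ => true

/-- Whether a symbol is not the right end marker. -/
def notRightEnd : InputSymbol → Bool
  | .rightEnd => false
  | _ => true

/-- Whether a symbol is the bit `1`. -/
def isOne : InputSymbol → Bool
  | .bit true => true
  | _ => false

/-- Move the input head back to the left end. -/
def rewind (T : ℕ) : Component T := loop (input T notLeftEnd .left)

theorem does_rewind (T : ℕ) (hip : ip ≤ w.length + 1) : (rewind T).Does w ip v true 0 v := by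
  induction ip with
  | zero => exact Does.loop_false (does_input T)
  | succ p ih =>
    have h := does_input T (w := w) (ip := p + 1) (v := v) (f := notLeftEnd) (h := .left)
    have h1 : notLeftEnd (OfflineTM.inputAt w (p + 1)) = true := by
      simp only [OfflineTM.inputAt]
      cases w[p]? <;> rfl
    rw [h1, show HeadMove.apply .left (p + 1) = p from rfl, min_eq_left (by omega)] at h
    exact Does.loop_true h (ih (by omega))

/-- Counter values in which counter `0` holds the input length, all counters are bounded by it,
and the counters from `m` on are cleared. -/
structure Env (w : List Bool) (m : ℕ) (v : ℕ → ℕ) : Prop where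
  zero : v 0 = w.length
  le : ∀ i, v i ≤ w.length
  clear : ∀ i, m ≤ i → v i = 0

theorem Env.update {m a : ℕ} (h : Env w m v) (hm : 0 < m) (ha : a ≤ w.length) :
    Env w (m + 1) (Function.update v m a) where
  zero := by rw [Function.update_of_ne hm.ne, h.zero]
  le i := by
    rw [Function.update_apply]
    split_ifs
    exacts [ha, h.le i]
  clear i hi := by rw [Function.update_of_ne (by omega), h.clear i (by omega)]

/-- `C` tests the predicate `R` of the first `m` counters. -/
def Tests (C : Component T) (m : ℕ) (R : List Bool → (ℕ → ℕ) → Prop) : Prop :=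
  ∀ w v, Env w m v → ∃ b, (b = true ↔ R w v) ∧ C.Does w 0 v b 0 v

section search

/-- Increase counter `m` until `C` answers `true` or the input length is reached. -/
noncomputable def search [NeZero T] (C : Component T) (m : Fin T) : Component T :=
  loop (cond C (skip T false) (cond (eq m 0) (skip T false) (inc m)))

/-- Stopping at `w.length` may mean success or failure, so a caller has to run `C` once more on the
result. -/
theorem does_search [NeZero T] {m : Fin T} {R : List Bool → (ℕ → ℕ) → Prop}
    (hC : C.Tests (m + 1) R) (hm : 0 < (m : ℕ)) (hv : Env w m v) {a : ℕ} (ha : a ≤ w.length) :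
    ∃ a' ≤ w.length, (∀ c, a ≤ c → c < a' → ¬ R w (Function.update v m c)) ∧
      (R w (Function.update v m a') ∨ a' = w.length) ∧
      (search C m).Does w 0 (Function.update v m a) true 0 (Function.update v m a') := by
  obtain ⟨r, hr⟩ : ∃ r, a + r = w.length := ⟨_, Nat.add_sub_cancel' ha⟩
  induction r generalizing a with
  | zero =>
    refine ⟨a, ha, fun c _ _ => by omega, .inr hr, Does.loop_false ?_⟩
    have hE := hv.update hm ha
    obtain ⟨b, -, hb⟩ := hC w _ hE
    cases b
    · refine hb.cond_false (.cond_true ?_ (does_skip T (by omega)))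
      have := does_eq (x := m) (y := 0) (ip := 0) (by omega) hE.le
      simpa [hm.ne, hv.zero, show a = w.length from hr] using this
    · exact hb.cond_true (does_skip T (by omega))
  | succ r ih =>
    have hE := hv.update hm ha
    obtain ⟨b, hbR, hb⟩ := hC w _ hE
    cases b
    · obtain ⟨a', ha', h1, h2, h3⟩ := ih (a := a + 1) (by omega) (by omega)
      refine ⟨a', ha', fun c hac hc => ?_, h2, Does.loop_true ?_ h3⟩
      · rcases hac.eq_or_lt with rfl | h
        · simpa using hbR
        · exact h1 c h hc
      · refine hb.cond_false (.cond_false ?_ ?_ (ip' := 0) (v' := Function.update v m a))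
        · have := does_eq (x := m) (y := 0) (ip := 0) (by omega) hE.le
          simpa [hm.ne, hv.zero, show a ≠ w.length by omega] using this
        · have := does_inc (x := m) (ip := 0) (by omega) hE.le
          simpa using this
    · exact ⟨a, ha, fun c _ _ => by omega, .inl (hbR.1 rfl),
        Does.loop_false (hb.cond_true (does_skip T (by omega)))⟩

end search

end Component

open Component

/-! ### Predicates which can be tested in logarithmic space -/

/-- The predicate `R` of the first `m` counters can be tested by a component. -/
def LS (m : ℕ) (R : List Bool → (ℕ → ℕ) → Prop) : Prop :=
  ∃ D, ∀ T, m + D ≤ T → ∃ C : Component T, C.Tests m R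

namespace LS

variable {m : ℕ} {R R' : List Bool → (ℕ → ℕ) → Prop}

theorem congr (h : LS m R) (hR : ∀ w v, Env w m v → (R w v ↔ R' w v)) : LS m R' := by
  obtain ⟨D, hD⟩ := h
  refine ⟨D, fun T hT => ?_⟩
  obtain ⟨C, hC⟩ := hD T hT
  refine ⟨C, fun w v hv => ?_⟩
  rw [← hR w v hv]
  exact hC w v hv

theorem not (h : LS m R) : LS m fun w v => ¬ R w v := by
  obtain ⟨D, hD⟩ := h
  refine ⟨D, fun T hT => ?_⟩
  obtain ⟨C, hC⟩ := hD T hT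
  refine ⟨cond C (skip T false) (skip T true), fun w v hv => ?_⟩
  obtain ⟨b, hbR, hb⟩ := hC w v hv
  simp only [← hbR]
  cases b
  · exact ⟨true, by simp, hb.cond_false (does_skip T (by omega))⟩
  · exact ⟨false, by simp, hb.cond_true (does_skip T (by omega))⟩

theorem and (h : LS m R) (h' : LS m R') : LS m fun w v => R w v ∧ R' w v := by
  obtain ⟨D, hD⟩ := h
  obtain ⟨D', hD'⟩ := h'
  refine ⟨max D D', fun T hT => ?_⟩
  obtain ⟨C, hC⟩ := hD T (by omega)
  obtain ⟨C', hC'⟩ := hD' T (by omega)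
  refine ⟨cond C C' (skip T false), fun w v hv => ?_⟩
  obtain ⟨b, hbR, hb⟩ := hC w v hv
  obtain ⟨b', hbR', hb'⟩ := hC' w v hv
  simp only [← hbR, ← hbR']
  cases b
  · exact ⟨false, by simp, hb.cond_false (does_skip T (by omega))⟩
  · exact ⟨b', by simp, hb.cond_true hb'⟩

theorem eq {x y : ℕ} (hx : x < m) (hy : y < m) : LS m fun _ v => v x = v y := by
  refine ⟨0, fun T hT => ?_⟩
  have : NeZero T := ⟨by omega⟩
  exact ⟨Component.eq ⟨x, by omega⟩ ⟨y, by omega⟩, fun w v hv =>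
    ⟨_, decide_eq_true_iff, does_eq (by omega) hv.le⟩⟩

/-- A scratch copy of `x` is incremented and compared with `y`. The case `v x = w.length` is handled
before, as the increment would exceed the bound; the answer is then negative since `v y ≤ w.length`.
-/
theorem succ {x y : ℕ} (hx : x < m) (hy : y < m) : LS m fun _ v => v x + 1 = v y := by
  refine ⟨1, fun T hT => ?_⟩
  have : NeZero T := ⟨by omega⟩
  let X : Fin T := ⟨x, by omega⟩
  let Y : Fin T := ⟨y, by omega⟩
  let M : Fin T := ⟨m, by omega⟩
  refine ⟨cond (Component.eq X 0) (skip T false) (seq (copy X m) (seq (inc M)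
    (cond (Component.eq M Y) (seq (clear T m) (skip T true)) (seq (clear T m) (skip T false))))),
    fun w v hv => ⟨decide (v x + 1 = v y), decide_eq_true_iff, ?_⟩⟩
  have hxm : x ≠ m := by omega
  have hym : y ≠ m := by omega
  have h1 := does_eq (x := X) (y := 0) (w := w) (ip := 0) (by omega) hv.le
  by_cases hxw : v x = w.length
  · have hl := hv.le y
    have hne : ¬ v x + 1 = v y := by omega
    simp only [hne]
    simp only [Fin.val_zero, hv.zero, X, hxw] at h1
    exact h1.cond_true (does_skip T (by omega))
  · simp only [Fin.val_zero, hv.zero, X, hxw] at h1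
    refine h1.cond_false ?_
    have hm : 0 < m := by omega
    have hE1 := hv.update hm (hv.le x)
    have hE2 := hv.update hm (show v x + 1 ≤ w.length by have := hv.le x; omega)
    refine (does_copy (by omega) hv.le).seq ((does_inc (by omega) hE1.le).seq ?_)
    have hself : Function.update v m 0 = v := by
      rw [← hv.clear m le_rfl, Function.update_eq_self]
    have h2 := does_eq (x := M) (y := Y) (w := w) (ip := 0) (by omega) hE2.le
    have h3 := does_clear (T := T) (x := m) (w := w) (ip := 0) (by omega) hE2.le
    simp only [Function.update_idem, hself] at h3
    simp only [M, Y, Function.update_self, Function.update_idem, ne_eq, hym, not_false_eq_true,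
      Function.update_of_ne] at h2 ⊢
    by_cases he : v x + 1 = v y
    · simp only [he, decide_true] at h2 h3 ⊢
      exact h2.cond_true (h3.seq (does_skip T (by omega)))
    · simp only [he, decide_false] at h2 ⊢
      exact h2.cond_false (h3.seq (does_skip T (by omega)))

/-- The input head moves right in step with a scratch counter until that counter equals `x`. One
more move is needed because cell `0` holds the end marker. -/
theorem bit {x : ℕ} (hx : x < m) : LS m fun w v => w[v x]? = some true := by
  refine ⟨1, fun T hT => ?_⟩
  have : NeZero T := ⟨by omega⟩
  let X : Fin T := ⟨x, by omega⟩
  let M : Fin T := ⟨m, by omega⟩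
  let advance : Component T := loop (cond (Component.eq M X) (skip T false)
    (seq (inc M) (input T (fun _ => true) .right)))
  refine ⟨seq advance (seq (input T (fun _ => true) .right) (cond (input T isOne .stay)
    (seq (rewind T) (seq (clear T m) (skip T true)))
    (seq (rewind T) (seq (clear T m) (skip T false))))), fun w v hv => ?_⟩
  have hm : 0 < m := by omega
  have hxm : x ≠ m := by omega
  have hself : Function.update v m 0 = v := by
    rw [← hv.clear m le_rfl, Function.update_eq_self]
  have hadv : ∀ r a, a + r = v x →
      advance.Does w a (Function.update v m a) true (v x) (Function.update v m (v x)) := by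
    intro r
    induction r with
    | zero =>
      rintro a rfl
      have hE := hv.update hm (hv.le x)
      refine Does.loop_false (Does.cond_true ?_ (does_skip T ?_))
      · have h := does_eq (x := M) (y := X) (w := w) (ip := v x)
          (by have := hv.le x; omega) hE.le
        simpa [M, X, hxm] using h
      · have := hv.le x
        omega
    | succ r ih =>
      intro a ha
      have hlx := hv.le x
      have hE := hv.update hm (show a ≤ w.length by omega)
      refine Does.loop_true (Does.cond_false ?_ (Does.seq (does_inc (ip := a) (by omega) hE.le) ?_))
        (ih (a + 1) (by omega)) (ip' := a + 1) (v' := Function.update v m (a + 1))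
      · have h := does_eq (x := M) (y := X) (w := w) (ip := a) (by omega) hE.le
        simpa [M, X, hxm, show a ≠ v x by omega] using h
      · have h := does_input T (w := w) (ip := a) (v := Function.update v m (a + 1))
          (f := fun _ => true) (h := .right)
        rw [show HeadMove.apply .right a = a + 1 from rfl, min_eq_left (by omega)] at h
        simpa [M] using h
  have hlx := hv.le x
  have hE := hv.update hm hlx
  have h0 := hadv (v x) 0 (by omega)
  rw [hself] at h0
  have h1 := does_input T (w := w) (ip := v x) (v := Function.update v m (v x))
    (f := fun _ => true) (h := .right)
  rw [show HeadMove.apply .right (v x) = v x + 1 from rfl, min_eq_left (by omega)] at h1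
  have h2 := does_input T (w := w) (ip := v x + 1) (v := Function.update v m (v x))
    (f := isOne) (h := .stay)
  rw [show HeadMove.apply .stay (v x + 1) = v x + 1 from rfl, min_eq_left (by omega)] at h2
  have h3 := does_clear (T := T) (x := m) (w := w) (ip := 0) (by omega) hE.le
  simp only [Function.update_idem, hself] at h3
  have h4 := does_rewind T (w := w) (ip := v x + 1) (v := Function.update v m (v x)) (by omega)
  refine ⟨isOne (OfflineTM.inputAt w (v x + 1)), ?_, h0.seq (h1.seq ?_)⟩
  · simp only [OfflineTM.inputAt]
    rcases w[v x]? with _ | _ | _ <;> simp [isOne]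
  · cases hb : isOne (OfflineTM.inputAt w (v x + 1)) <;> rw [hb] at h2
    · exact h2.cond_false (h4.seq (h3.seq (does_skip T (by omega))))
    · exact h2.cond_true (h4.seq (h3.seq (does_skip T (by omega))))

/-- A search over the fresh counter `m` is followed by a second test, and then the counter is
cleared again. -/
theorem ex (hm : 0 < m) (h : LS (m + 1) R) :
    LS m fun w v => ∃ a ≤ w.length, R w (Function.update v m a) := by
  obtain ⟨D, hD⟩ := h
  refine ⟨D + 1, fun T hT => ?_⟩
  have : NeZero T := ⟨by omega⟩
  obtain ⟨C, hC⟩ := hD T (by omega)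
  let M : Fin T := ⟨m, by omega⟩
  refine ⟨seq (search C M) (cond C (seq (clear T m) (skip T true))
    (seq (clear T m) (skip T false))), fun w v hv => ?_⟩
  have hself : Function.update v m 0 = v := by
    rw [← hv.clear m le_rfl, Function.update_eq_self]
  obtain ⟨a, ha, h1, h2, h3⟩ := does_search (m := M) hC hm hv (Nat.zero_le _)
  simp only [M, hself] at h1 h2 h3
  have hE := hv.update hm ha
  have h4 := does_clear (T := T) (x := m) (w := w) (ip := 0) (by omega) hE.le
  simp only [Function.update_idem, hself] at h4
  obtain ⟨b, hbR, hb⟩ := hC w _ hE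
  refine ⟨b, ?_, h3.seq ?_⟩
  · refine ⟨fun h => ⟨a, ha, hbR.1 h⟩, ?_⟩
    rintro ⟨c, hc, hcR⟩
    rcases h2 with h2 | rfl
    · exact hbR.2 h2
    · rcases hc.lt_or_eq with hlt | rfl
      · exact absurd hcR (h1 c (Nat.zero_le _) hlt)
      · exact hbR.2 hcR
  · cases b
    · exact hb.cond_false (h4.seq (does_skip T (by omega)))
    · exact hb.cond_true (h4.seq (does_skip T (by omega)))

end LS

/-! ### Iterating a least-successor relation -/

/-- `c` is the least number in relation `R` to `a`. -/
def LeastRel (R : ℕ → ℕ → Prop) (a c : ℕ) : Prop := R a c ∧ ∀ c' < c, ¬ R a c'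

/-- `b` is reached from `a` by `j` steps to the respective least `R`-successor, provided that the
successors are at most `N`. -/
def LeastPow (N : ℕ) (R : ℕ → ℕ → Prop) : ℕ → ℕ → ℕ → Prop
  | 0, a, b => a = b
  | j + 1, a, b => ∃ c ≤ N, LeastRel R a c ∧ LeastPow N R j c b

theorem LeastRel.unique {R : ℕ → ℕ → Prop} {a c c' : ℕ} (h : LeastRel R a c)
    (h' : LeastRel R a c') : c = c' := by
  rcases lt_trichotomy c c' with hc | hc | hc
  exacts [absurd h.1 (h'.2 c hc), hc, absurd h'.1 (h.2 c' hc)]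

theorem LeastPow.unique {N : ℕ} {R : ℕ → ℕ → Prop} {j a b b' : ℕ} (h : LeastPow N R j a b)
    (h' : LeastPow N R j a b') : b = b' := by
  induction j generalizing a with
  | zero => exact h.symm.trans h'
  | succ j ih =>
    obtain ⟨c, -, hc, hb⟩ := h
    obtain ⟨c', -, hc', hb'⟩ := h'
    obtain rfl := hc.unique hc'
    exact ih hb hb'

open Component

namespace LS

variable {m : ℕ}

/-- Taking least successors makes the iteration deterministic, so three scratch counters suffice:
the number of steps done in `m`, the current point in `m + 1`, the candidate for its successor in `m
+ 2`. -/
theorem pow {x c y : ℕ} {E : List Bool → (ℕ → ℕ) → Prop}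
    {R : List Bool → (ℕ → ℕ) → ℕ → ℕ → Prop} (h : LS (m + 3) E)
    (hE : ∀ w v i a d, Env w m v → i ≤ w.length → a ≤ w.length → d ≤ w.length →
      (E w (Function.update (Function.update (Function.update v m i) (m + 1) a) (m + 2) d) ↔
        R w v a d)) (hx : x < m) (hc : c < m) (hy : y < m) :
    LS m fun w v => LeastPow w.length (R w v) (v c) (v x) (v y) := by
  obtain ⟨D, hD⟩ := h
  refine ⟨D + 3, fun T hT => ?_⟩
  have : NeZero T := ⟨by omega⟩
  obtain ⟨C, hC⟩ := hD T (by omega)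
  let X : Fin T := ⟨x, by omega⟩
  let Y : Fin T := ⟨y, by omega⟩
  let K : Fin T := ⟨c, by omega⟩
  let M : Fin T := ⟨m, by omega⟩
  let M1 : Fin T := ⟨m + 1, by omega⟩
  let M2 : Fin T := ⟨m + 2, by omega⟩
  let body : Component T := cond (Component.eq M K) (skip T false) (seq (search C M2)
    (cond C (seq (copy M2 (m + 1)) (seq (clear T (m + 2)) (inc M)))
      (seq (clear T (m + 2)) (skip T false))))
  let finish : Bool → Component T := fun b => seq (clear T m) (seq (clear T (m + 1)) (skip T b))
  refine ⟨seq (copy X (m + 1)) (seq (loop body) (cond (Component.eq M K)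
    (cond (Component.eq M1 Y) (finish true) (finish false)) (finish false))), fun w v hv => ?_⟩
  have hm : 0 < m := by omega
  -- the counters during the iteration
  let f : ℕ → ℕ → ℕ → ℕ → ℕ := fun i a d =>
    Function.update (Function.update (Function.update v m i) (m + 1) a) (m + 2) d
  have hf2 : ∀ i a d d', Function.update (f i a d) (m + 2) d' = f i a d' := fun i a d d' => by
    simp [f]
  have hf1 : ∀ i a d a', Function.update (f i a d) (m + 1) a' = f i a' d := fun i a d a' => by
    ext z
    simp only [f, Function.update_apply]
    split_ifs <;> first | rfl | omega
  have hf0 : ∀ i a d i', Function.update (f i a d) m i' = f i' a d := fun i a d i' => by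
    ext z
    simp only [f, Function.update_apply]
    split_ifs <;> first | rfl | omega
  have hf000 : f 0 0 0 = v := by
    have h0 := hv.clear m le_rfl
    have h1 := hv.clear (m + 1) (by omega)
    have h2 := hv.clear (m + 2) (by omega)
    ext z
    simp only [f, Function.update_apply]
    split_ifs with hz2 hz1 hz0
    · rw [hz2, h2]
    · rw [hz1, h1]
    · rw [hz0, h0]
    · rfl
  have fm : ∀ i a d, f i a d m = i := fun i a d => by simp [f]
  have fm1 : ∀ i a d, f i a d (m + 1) = a := fun i a d => by simp [f]
  have fm2 : ∀ i a d, f i a d (m + 2) = d := fun i a d => by simp [f]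
  have flt : ∀ i a d z, z < m → f i a d z = v z := fun i a d z hz => by
    simp [f, show z ≠ m by omega, show z ≠ m + 1 by omega, show z ≠ m + 2 by omega]
  have env3 : ∀ {i a d}, i ≤ w.length → a ≤ w.length → d ≤ w.length → Env w (m + 3) (f i a d) :=
    fun hi ha hd => ((hv.update hm hi).update (by omega) ha).update (by omega) hd
  have env2 : ∀ {i a}, i ≤ w.length → a ≤ w.length → Env w (m + 2) (f i a 0) := by
    intro i a hi ha
    refine ⟨(env3 hi ha (Nat.zero_le _)).zero, (env3 hi ha (Nat.zero_le _)).le, fun z hz => ?_⟩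
    rcases hz.eq_or_lt with rfl | hz
    · exact fm2 _ _ _
    · exact (env3 hi ha (Nat.zero_le _)).clear z hz
  -- With `r` steps to go, the loop either completes them or stops early at a point without
  -- successor. The step counter differs from `v c` exactly in the second case, which is how the
  -- final test tells them apart.
  have hloop : ∀ r i a, i + r = v c → a ≤ w.length → ∃ i' a', i' ≤ w.length ∧ a' ≤ w.length ∧
      (loop body).Does w 0 (f i a 0) true 0 (f i' a' 0) ∧
      ((i' = v c ∧ LeastPow w.length (R w v) r a a') ∨
        (i' ≠ v c ∧ ∀ b, ¬ LeastPow w.length (R w v) r a b)) := by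
    have hcw := hv.le c
    intro r
    induction r with
    | zero =>
      rintro i a rfl ha
      refine ⟨_, a, hcw, ha, Does.loop_false (Does.cond_true ?_ (does_skip T (by omega))),
        .inl ⟨rfl, rfl⟩⟩
      have h := does_eq (x := M) (y := K) (w := w) (ip := 0) (by omega) (env2 hcw ha).le
      simpa [M, K, fm, flt _ _ _ _ hc] using h
    | succ r ih =>
      intro i a hi ha
      have hiw : i ≤ w.length := by omega
      have h1 := does_eq (x := M) (y := K) (w := w) (ip := 0) (by omega) (env2 hiw ha).le
      simp only [M, K, fm, flt _ _ _ _ hc, show i ≠ v c by omega, decide_false] at h1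
      obtain ⟨d, hd, h2, h3, h4⟩ := does_search (m := M2) hC (by simp [M2]) (env2 hiw ha)
        (Nat.zero_le _)
      simp only [M2, hf2] at h2 h3 h4
      have hER : ∀ d ≤ w.length, E w (f i a d) ↔ R w v a d := fun d hd => hE w v i a d hv hiw ha hd
      have h5 := does_clear (T := T) (x := m + 2) (w := w) (ip := 0) (by omega) (env3 hiw ha hd).le
      rw [hf2] at h5
      obtain ⟨b, hbR, hb⟩ := hC w _ (env3 hiw ha hd)
      cases b
      · refine ⟨i, a, hiw, ha, Does.loop_false (h1.cond_false (h4.seq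
          (hb.cond_false (h5.seq (does_skip T (by omega)))))), .inr ⟨by omega, ?_⟩⟩
        rintro b ⟨d', hd', hl, -⟩
        have hn : ¬ E w (f i a d) := fun h => by simpa using hbR.2 h
        -- The search ended at the bound without a witness, so there is no successor in range.
        obtain rfl := h3.resolve_left hn
        rcases hd'.lt_or_eq with hlt | rfl
        · exact h2 d' (Nat.zero_le _) hlt ((hER d' hd').2 hl.1)
        · exact hn ((hER _ hd).2 hl.1)
      · have hl : LeastRel (R w v) a d := ⟨(hER d hd).1 (hbR.1 rfl), fun d' hd' hR =>
          h2 d' (Nat.zero_le _) hd' ((hER d' (by omega)).2 hR)⟩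
        obtain ⟨i', a', hi', ha', h6, h7⟩ := ih (i + 1) d (by omega) hd
        have h8 := does_copy (x := M2) (y := m + 1) (w := w) (ip := 0) (by omega)
          (env3 hiw ha hd).le
        have h9 := does_clear (T := T) (x := m + 2) (w := w) (ip := 0) (by omega)
          (env3 hiw hd hd).le
        have h10 := does_inc (x := M) (w := w) (ip := 0) (by omega) (env2 hiw hd).le
        simp only [M2, M, hf0, hf1, hf2, fm, fm2] at h8 h9 h10
        refine ⟨i', a', hi', ha', Does.loop_true (h1.cond_false (h4.seq (hb.cond_true
          (h8.seq (h9.seq h10))))) h6, h7.imp (fun h => ⟨h.1, d, hd, hl, h.2⟩) ?_⟩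
        rintro ⟨h, h'⟩
        refine ⟨h, ?_⟩
        rintro b ⟨d', hd', hl', hp⟩
        obtain rfl := hl.unique hl'
        exact h' b hp
  have hfin : ∀ b i a, i ≤ w.length → a ≤ w.length → (finish b).Does w 0 (f i a 0) b 0 v := by
    intro b i a hi ha
    have h1 := does_clear (T := T) (x := m) (w := w) (ip := 0) (by omega) (env2 hi ha).le
    have h2 := does_clear (T := T) (x := m + 1) (w := w) (ip := 0) (by omega)
      (env2 (Nat.zero_le _) ha).le
    rw [hf0] at h1
    rw [hf1, hf000] at h2
    exact h1.seq (h2.seq (does_skip T (by omega)))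
  have h1 := does_copy (x := X) (y := m + 1) (w := w) (ip := 0) (by omega) hv.le
  rw [← hf000, hf1, hf000] at h1
  obtain ⟨i', a', hi', ha', h2, h3⟩ := hloop (v c) 0 (v x) (by omega) (hv.le x)
  have h4 := does_eq (x := M) (y := K) (w := w) (ip := 0) (by omega) (env2 hi' ha').le
  have h5 := does_eq (x := M1) (y := Y) (w := w) (ip := 0) (by omega) (env2 hi' ha').le
  simp only [M, M1, K, Y, fm, fm1, flt _ _ _ _ hc, flt _ _ _ _ hy] at h4 h5
  rcases h3 with ⟨he, hp⟩ | ⟨hne, hp⟩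
  · subst he
    simp only [decide_true] at h4
    by_cases hay : a' = v y
    · subst hay
      simp only [decide_true] at h5
      exact ⟨true, by simpa using hp, h1.seq (h2.seq (h4.cond_true (h5.cond_true
        (hfin _ _ _ hi' ha'))))⟩
    · simp only [hay, decide_false] at h5
      refine ⟨false, ?_, h1.seq (h2.seq (h4.cond_true (h5.cond_false (hfin _ _ _ hi' ha'))))⟩
      simp only [Bool.false_eq_true, false_iff]
      intro hp'
      exact hay (hp.unique hp')
  · simp only [hne, decide_false] at h4
    exact ⟨false, by simpa using hp _, h1.seq (h2.seq (h4.cond_false (hfin _ _ _ hi' ha')))⟩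

/-- Counter `0` is reserved for the input length, which bounds all searches and has to be computed
before `C` starts. -/
theorem inLogspace {R : List Bool → Prop} (h : LS 1 fun w _ => R w) :
    InLogspace {w | R w} := by
  obtain ⟨D, hD⟩ := h
  obtain ⟨C, hC⟩ := hD (1 + D) le_rfl
  have : NeZero (1 + D) := ⟨by omega⟩
  let count : Component (1 + D) := loop (cond (input (1 + D) notRightEnd .right)
    (inc 0) (skip (1 + D) false))
  -- The tapes are initially blank even in cell `0`, so the left-end markers are written first.
  let P : Component (1 + D) := seq (atom (fun _ => true) .stay fun _ => none)
    (seq (input (1 + D) (fun _ => true) .right) (seq count (seq (rewind (1 + D)) C)))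
  let e : ℕ → ℕ → ℕ := fun a => Function.update (fun _ => 0) 0 a
  have he : ∀ a, e a 0 = a := fun a => by simp [e]
  have hle : ∀ {w : List Bool} {a}, a ≤ w.length → ∀ i, e a i ≤ w.length := by
    intro w a ha i
    simp only [e, Function.update_apply]
    split_ifs <;> omega
  have hcount : ∀ (w : List Bool) r a, a + r = w.length →
      count.Does w (a + 1) (e a) true (w.length + 1) (e w.length) := by
    intro w r
    induction r with
    | zero =>
      rintro a ha
      obtain rfl : a = w.length := ha
      have h := does_input (1 + D) (w := w) (ip := w.length + 1) (v := e w.length)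
        (f := notRightEnd) (h := .right)
      have h' : notRightEnd (OfflineTM.inputAt w (w.length + 1)) = false := by
        simp [OfflineTM.inputAt, notRightEnd]
      rw [h', min_eq_right (by simp [HeadMove.apply])] at h
      exact Does.loop_false (h.cond_false (does_skip _ le_rfl))
    | succ r ih =>
      intro a ha
      have h := does_input (1 + D) (w := w) (ip := a + 1) (v := e a)
        (f := notRightEnd) (h := .right)
      have h' : notRightEnd (OfflineTM.inputAt w (a + 1)) = true := by
        simp [OfflineTM.inputAt, notRightEnd, List.getElem?_eq_getElem (show a < w.length by omega)]
      rw [h', show HeadMove.apply .right (a + 1) = a + 1 + 1 from rfl,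
        min_eq_left (by omega)] at h
      have h2 := does_inc (x := (0 : Fin (1 + D))) (w := w) (ip := a + 1 + 1) (v := e a) (by omega)
        (hle (by omega))
      simp only [Fin.val_zero, he] at h2
      have h3 : Function.update (e a) 0 (a + 1) = e (a + 1) := by simp [e]
      rw [h3] at h2
      exact Does.loop_true (h.cond_true h2) (ih (a + 1) (by omega))
  have hrun : ∀ w, ∃ b v, (b = true ↔ R w) ∧ P.Run w (space w) P.start
      ⟨0, fun _ _ => some none, fun _ => 0⟩ b (store (1 + D) 0 v) := by
    intro w
    have hE : Env w 1 (e w.length) := ⟨he _, hle le_rfl, fun i hi => by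
      simp [e, show i ≠ 0 by omega]⟩
    obtain ⟨b, hb, hbC⟩ := hC w _ hE
    refine ⟨b, _, hb, Run.cond_true (b := true) (d' := store (1 + D) 0 (e 0)) ?_ rfl
      (Does.seq (does_input (1 + D)) (Does.seq (hcount w _ 0 (Nat.zero_add _))
        ((does_rewind (1 + D) le_rfl).seq hbC)))⟩
    have h := Run.atom (w := w) (S := space w) (f := fun _ => true) (h := .stay)
      (g := fun _ => none) (d := (⟨0, fun _ _ => some none, fun _ => 0⟩ : Memory (1 + D)))
      (fun _ => show 0 < space w by unfold space; omega)
    -- The number `0` has no binary digits, so a tape that is blank after its marker holds `0`.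
    have hstore : store (1 + D) 0 (e 0) = (⟨0,
        fun _ => Function.update (fun _ => some none) 0 none, fun _ => 0⟩ : Memory (1 + D)) := by
      have h0 : e 0 = fun _ => 0 := by simp [e]
      ext i j : 3
      · rfl
      · rcases j with _ | j <;> simp [store, Memory.ofCells, h0]
      · rfl
    rw [hstore]
    exact h
  refine ⟨P.toTM, 4, fun w => ?_, fun w m i => ?_⟩
  · obtain ⟨b, v, hb, hr⟩ := hrun w
    obtain ⟨⟨m, hm⟩, -⟩ := hr.toTM
    have hout : P.toTM.Outputs w b := by
      refine ⟨m, ?_⟩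
      change P.toTM.verdict ((P.toTM.step w)^[m] _).state = _
      erw [hm]
      rfl
    refine ⟨fun hw => ?_, fun hw => ?_⟩
    · rwa [hb.2 hw] at hout
    · cases b
      · exact hout
      · exact absurd (hb.1 rfl) hw
  · obtain ⟨b, v, -, hr⟩ := hrun w
    have h1 := hr.toTM.2 m i
    -- The factor `4` comes from `space w ≤ (Nat.log 2 w.length + 1) + 3`.
    have h2 : space w ≤ 4 * (Nat.log 2 w.length + 1) := by
      have : Nat.size w.length ≤ Nat.log 2 w.length + 1 :=
        Nat.size_le.2 (Nat.lt_pow_succ_log_self (by norm_num) _)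
      unfold space
      omega
    exact lt_of_lt_of_le h1 h2

end LS

/-- The relation `R` can be tested for any counters. -/
def LSRel (n : ℕ) (R : List Bool → (Fin n → ℕ) → Prop) : Prop :=
  ∀ (m : ℕ) (x : Fin n → ℕ), 0 < m → (∀ i, x i < m) → LS m fun w v => R w fun i => v (x i)

/-! ### Closure properties of testable relations -/

namespace LSRel

variable {n : ℕ} {R R' : List Bool → (Fin n → ℕ) → Prop}

theorem congr (h : LSRel n R) (hR : ∀ w a, (∀ i, a i ≤ w.length) → (R w a ↔ R' w a)) :
    LSRel n R' := fun m x hm hx =>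
  (h m x hm hx).congr fun w _ hv => hR w _ fun _ => hv.le _

theorem subst (h : LSRel n R) {n' : ℕ} (f : Fin n → Fin n') :
    LSRel n' fun w a => R w fun i => a (f i) := fun m x hm hx =>
  h m (fun i => x (f i)) hm fun i => hx (f i)

theorem not (h : LSRel n R) : LSRel n fun w a => ¬ R w a := fun m x hm hx => (h m x hm hx).not

theorem and (h : LSRel n R) (h' : LSRel n R') : LSRel n fun w a => R w a ∧ R' w a :=
  fun m x hm hx => (h m x hm hx).and (h' m x hm hx)

theorem imp (h : LSRel n R) (h' : LSRel n R') : LSRel n fun w a => R w a → R' w a :=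
  (h.and h'.not).not.congr fun _ _ _ => by tauto

theorem or (h : LSRel n R) (h' : LSRel n R') : LSRel n fun w a => R w a ∨ R' w a :=
  (h.not.and h'.not).not.congr fun _ _ _ => by tauto

theorem iff (h : LSRel n R) (h' : LSRel n R') : LSRel n fun w a => R w a ↔ R' w a :=
  ((h.imp h').and (h'.imp h)).congr fun _ _ _ => by tauto

/-- The bound variable becomes variable `0` and the others shift up, as with de Bruijn indices. This
convention determines the index vectors passed to `subst`. -/
theorem ex {R : List Bool → (Fin (n + 1) → ℕ) → Prop} (h : LSRel (n + 1) R) :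
    LSRel n fun w a => ∃ c ≤ w.length, R w (Fin.cons c a) := fun m x hm hx => by
  refine (LS.ex hm (h (m + 1) (Fin.cons m x) (by omega) fun i => ?_)).congr fun w v hv => ?_
  · refine Fin.cases ?_ (fun i => ?_) i
    · simp
    · simpa using (hx i).trans (Nat.lt_succ_self m)
  · refine exists_congr fun c => and_congr_right fun _ => iff_of_eq (congrArg _ ?_)
    ext i
    refine Fin.cases ?_ (fun i => ?_) i
    · simp
    · simp [(hx i).ne]

theorem all {R : List Bool → (Fin (n + 1) → ℕ) → Prop} (h : LSRel (n + 1) R) :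
    LSRel n fun w a => ∀ c ≤ w.length, R w (Fin.cons c a) :=
  h.not.ex.not.congr fun _ _ _ => by push Not; rfl

/-- Variables `0`, `1`, `2` are the number of steps, the start and the end; the remaining ones are
parameters of the iterated relation. -/
theorem pow {E : List Bool → (Fin (n + 2) → ℕ) → Prop} (h : LSRel (n + 2) E) :
    LSRel (n + 3) fun w a => LeastPow w.length
      (fun p q => E w (Fin.cons p (Fin.cons q fun i => a i.succ.succ.succ))) (a 0) (a 1) (a 2) :=
  fun m x hm hx => by
    refine LS.pow
      (R := fun w v p q => E w (Fin.cons p (Fin.cons q fun i => v (x i.succ.succ.succ))))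
      (h (m + 3) (Fin.cons (m + 1) (Fin.cons (m + 2) fun i => x i.succ.succ.succ)) (by omega) ?_)
      ?_ (hx 1) (hx 0) (hx 2)
    · refine Fin.cases ?_ (Fin.cases ?_ fun i => ?_)
      · simp
      · simp
      · simpa using (hx _).trans (by omega)
    · intro w v i a d _ _ _ _
      refine iff_of_eq (congrArg _ ?_)
      ext i
      refine Fin.cases ?_ (Fin.cases ?_ fun i => ?_) i
      · simp
      · simp
      · have := hx i.succ.succ.succ
        simp [this.ne, (show x i.succ.succ.succ ≠ m + 1 by omega),
          (show x i.succ.succ.succ ≠ m + 2 by omega)]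

/-- The bound `k` is a constant of the machine, so this is a finite conjunction and costs no counter
for `j`. -/
theorem forall_le {R : ℕ → List Bool → (Fin n → ℕ) → Prop} (h : ∀ j, LSRel n (R j)) (k : ℕ) :
    LSRel n fun w a => ∀ j ≤ k, R j w a := by
  induction k with
  | zero => exact (h 0).congr fun _ _ _ => by simp
  | succ k ih =>
    exact (ih.and (h (k + 1))).congr fun _ _ _ => by
      simp [Nat.le_succ_iff, or_imp, forall_and]

end LSRel

/-! ### Arithmetic -/

theorem LeastRel.iff_of_unique {R : ℕ → ℕ → Prop} {a c : ℕ} (h : ∀ c', R a c' → c' = c) :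
    LeastRel R a c ↔ R a c :=
  ⟨And.left, fun hc => ⟨hc, fun c' hlt hc' => hlt.ne (h c' hc')⟩⟩

/-- Intermediate sums never exceed the final value `b ≤ N`, so the bound in `LeastPow` does no harm.
-/
theorem leastPow_add {N n j a b : ℕ} (hb : b ≤ N) :
    LeastPow N (fun p q => p + n = q) j a b ↔ a + j * n = b := by
  induction j generalizing a with
  | zero => simp [LeastPow]
  | succ j ih =>
    simp only [LeastPow, ih]
    constructor
    · rintro ⟨c, -, hc, h⟩
      have := hc.1
      rw [← h, ← this]
      ring
    · intro h
      refine ⟨a + n, le_trans ?_ hb, ⟨rfl, fun c' h1 h2 => by omega⟩, by rw [← h]; ring⟩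
      rw [← h, Nat.succ_mul]
      omega

theorem lsRel_eq : LSRel 2 fun _ a => a 0 = a 1 := fun _ _ _ hx => LS.eq (hx 0) (hx 1)

theorem lsRel_succ : LSRel 2 fun _ a => a 0 + 1 = a 1 := fun _ _ _ hx => LS.succ (hx 0) (hx 1)

theorem lsRel_bit : LSRel 1 fun w a => w[a 0]? = some true := fun _ _ _ hx => LS.bit (hx 0)

theorem lsRel_true (n : ℕ) : LSRel n fun _ _ => True := by
  have h := (lsRel_eq.subst ![0, 0]).ex (n := 0)
  refine (h.subst Fin.elim0).congr fun w a _ => ?_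
  simp only [iff_true]
  exact ⟨0, Nat.zero_le _, rfl⟩

theorem lsRel_add : LSRel 3 fun _ a => a 0 + a 1 = a 2 :=
  ((LSRel.pow (n := 0) lsRel_succ).subst ![1, 0, 2]).congr fun w a ha => by
    have := leastPow_add (n := 1) (j := a 1) (a := a 0) (ha 2)
    rw [mul_one] at this
    exact this

/-- Multiplication is iterated addition from `0`. The starting value is described by `c + c = c`,
since the terms contain only variables. -/
theorem lsRel_mul : LSRel 3 fun _ a => a 0 * a 1 = a 2 := by
  have h1 := (LSRel.pow (n := 1) (lsRel_add.subst ![0, 2, 1])).subst (n' := 4) ![1, 0, 3, 2]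
  have h2 := (((lsRel_add.subst ![0, 0, 0]).and h1).ex (n := 3))
  refine h2.congr fun w a ha => ?_
  have := leastPow_add (n := a 1) (j := a 0) (a := 0) (ha 2)
  rw [zero_add] at this
  rw [← this]
  constructor
  · rintro ⟨c, hc, h0, h⟩
    obtain rfl : c = 0 := by
      have : c + c = c := h0
      omega
    exact h
  · intro h
    exact ⟨0, Nat.zero_le _, rfl, h⟩

theorem lsRel_le : LSRel 2 fun _ a => a 0 ≤ a 1 :=
  (lsRel_add.subst (n' := 3) ![1, 0, 2]).ex.congr fun w a ha => by
    refine ⟨?_, fun h => ⟨a 1 - a 0, by have := ha 1; omega, Nat.add_sub_cancel' h⟩⟩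
    rintro ⟨c, -, hc⟩
    have hc : a 0 + c = a 1 := hc
    omega

theorem lsRel_lt : LSRel 2 fun _ a => a 0 < a 1 :=
  (lsRel_le.subst ![1, 0]).not.congr fun _ _ _ => not_le

/-! ### Parsing -/

/-- `q` is the first position from `p` on which does not carry the bit `1`. -/
def IsNextZero (w : List Bool) (p q : ℕ) : Prop :=
  p ≤ q ∧ w[q]? ≠ some true ∧ ∀ i ≤ w.length, p ≤ i ∧ i < q → w[i]? = some true

theorem lsRel_isNextZero : LSRel 2 fun w a => IsNextZero w (a 0) (a 1) :=
  (lsRel_le.and ((lsRel_bit.subst ![1]).not.and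
    (((lsRel_le.subst (n' := 3) ![1, 0]).and (lsRel_lt.subst ![0, 2])).imp
      (lsRel_bit.subst ![0])).all) :)

/-- The input starts with `1ⁿ 0 1ˢ 0 1ᵗ 0`, and `b` is the position of the next bit. -/
def IsHeader (w : List Bool) (n s t b : ℕ) : Prop :=
  ∃ o ≤ w.length, o + o = o ∧ IsNextZero w o n ∧ ∃ p₁ ≤ w.length, n + 1 = p₁ ∧ ∃ p₂ ≤ w.length,
    IsNextZero w p₁ p₂ ∧ p₁ + s = p₂ ∧ ∃ p₃ ≤ w.length, p₂ + 1 = p₃ ∧ ∃ p₄ ≤ w.length,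
      IsNextZero w p₃ p₄ ∧ p₃ + t = p₄ ∧ p₄ + 1 = b

theorem lsRel_isHeader : LSRel 4 fun w a => IsHeader w (a 0) (a 1) (a 2) (a 3) := by
  -- Variables in order of index: `p₄ p₃ p₂ p₁ o n s t b`.
  have h4 := ((lsRel_isNextZero.subst (n' := 9) ![1, 0]).and ((lsRel_add.subst ![1, 7, 0]).and
    (lsRel_succ.subst ![0, 8]))).ex
  have h3 := ((lsRel_succ.subst (n' := 8) ![1, 0]).and h4).ex
  have h2 := ((lsRel_isNextZero.subst (n' := 7) ![1, 0]).and
    ((lsRel_add.subst ![1, 4, 0]).and h3)).ex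
  have h1 := ((lsRel_succ.subst (n' := 6) ![2, 0]).and h2).ex
  exact ((lsRel_add.subst (n' := 5) ![0, 0, 0]).and
    ((lsRel_isNextZero.subst ![0, 1]).and h1)).ex

/-- The adjacency relation given by the input. -/
def inputAdj (w : List Bool) (u v : ℕ) : Prop :=
  ∃ n ≤ w.length, ∃ s ≤ w.length, ∃ t ≤ w.length, ∃ b ≤ w.length, IsHeader w n s t b ∧ u < n ∧
    v < n ∧ ∃ p ≤ w.length, u * n = p ∧ ∃ q ≤ w.length, b + p = q ∧ ∃ r ≤ w.length, q + v = r ∧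
      w[r]? = some true

theorem lsRel_inputAdj : LSRel 2 fun w a => inputAdj w (a 0) (a 1) := by
  -- counters: b t s n u v
  have h3 := ((lsRel_add.subst (n' := 9) ![1, 8, 0]).and (lsRel_bit.subst ![0])).ex
  have h2 := ((lsRel_add.subst (n' := 8) ![2, 1, 0]).and h3).ex
  have h1 := ((lsRel_mul.subst (n' := 7) ![5, 4, 0]).and h2).ex
  exact ((lsRel_isHeader.subst (n' := 6) ![3, 2, 1, 0]).and ((lsRel_lt.subst ![4, 3]).and
    ((lsRel_lt.subst ![5, 3]).and h1))).ex.ex.ex.ex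

/-! ### Linking the arcs of a digraph on the natural numbers -/

/-- At least `j` numbers below `u` satisfy `p`. -/
def RankGE (p : ℕ → Prop) : ℕ → ℕ → Prop
  | 0, _ => True
  | j + 1, u => ∃ u' < u, p u' ∧ RankGE p j u'

/-- The arc `(v, v')` follows the arc `(u, v)`: their ranks among the arcs into and out of `v` agree
up to `k`. -/
def Link (A : ℕ → ℕ → Prop) (k u v v' : ℕ) : Prop :=
  A u v ∧ A v v' ∧ ∀ j ≤ k, RankGE (fun u => A u v) j u ↔ RankGE (A v) j v'

/-- `a` is the code of the arc `(u, v)`. -/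
def IsCode (N n u v a : ℕ) : Prop := ∃ p ≤ N, u * n = p ∧ p + v = a

/-- `Link`, for codes of arcs. -/
def CodeLink (N : ℕ) (A : ℕ → ℕ → Prop) (k n a a' : ℕ) : Prop :=
  ∃ u ≤ N, ∃ v ≤ N, ∃ v' ≤ N, IsCode N n u v a ∧ IsCode N n v v' a' ∧ Link A k u v v'

/-- `y` comes after `x` on a path formed by linked arcs. -/
def Along (N : ℕ) (A : ℕ → ℕ → Prop) (k n x y : ℕ) : Prop :=
  x = y ∨ ∃ x' ≤ N, ∃ y' ≤ N, ∃ a ≤ N, ∃ b ≤ N, ∃ j ≤ N, IsCode N n x x' a ∧ A x x' ∧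
    IsCode N n y' y b ∧ A y' y ∧ LeastPow N (CodeLink N A k n) j a b

/-- `y` is reached from `x` along `j` segments of such paths. -/
def AlongPow (N : ℕ) (A : ℕ → ℕ → Prop) (k n : ℕ) : ℕ → ℕ → ℕ → Prop
  | 0, x, y => x = y
  | j + 1, x, y => ∃ z ≤ N, Along N A k n x z ∧ AlongPow N A k n j z y

/-- The language decided by the machine. -/
def Accepted (k : ℕ) (w : List Bool) : Prop :=
  ∃ n ≤ w.length, ∃ s ≤ w.length, ∃ t ≤ w.length, ∃ b ≤ w.length, IsHeader w n s t b ∧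
    AlongPow w.length (inputAdj w) k n k s t

section

variable {A : List Bool → ℕ → ℕ → Prop}

/-- A rank threshold `j` is expressed by `j` nested quantifiers, so no counting program is needed.
-/
theorem lsRel_rankGE (h : LSRel 2 fun w a => A w (a 0) (a 1)) (j : ℕ) :
    LSRel 2 fun w a => RankGE (fun u => A w u (a 1)) j (a 0) := by
  induction j with
  | zero => exact lsRel_true 2
  | succ j ih =>
    refine ((lsRel_lt.subst (n' := 3) ![0, 1]).and
      ((h.subst ![0, 2]).and (ih.subst ![0, 2]))).ex.congr fun w a ha => ?_
    refine ⟨?_, fun ⟨c, hc, h⟩ => ⟨c, hc.le.trans (ha 0), hc, h⟩⟩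
    rintro ⟨c, -, hc, h⟩
    exact ⟨c, hc, h⟩

theorem lsRel_link (h : LSRel 2 fun w a => A w (a 0) (a 1)) (k : ℕ) :
    LSRel 3 fun w a => Link (A w) k (a 0) (a 1) (a 2) :=
  ((h.subst (n' := 3) ![0, 1]).and ((h.subst ![1, 2]).and (LSRel.forall_le (fun j =>
    ((lsRel_rankGE h j).subst ![0, 1]).iff
      ((lsRel_rankGE (A := fun w u v => A w v u) (h.subst ![1, 0]) j).subst ![2, 1])) k)) :)

theorem lsRel_isCode : LSRel 4 fun w a => IsCode w.length (a 0) (a 1) (a 2) (a 3) :=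
  (((lsRel_mul.subst (n' := 5) ![2, 1, 0]).and (lsRel_add.subst ![0, 3, 4])).ex :)

theorem lsRel_codeLink (h : LSRel 2 fun w a => A w (a 0) (a 1)) (k : ℕ) :
    LSRel 3 fun w a => CodeLink w.length (A w) k (a 2) (a 0) (a 1) :=
  -- counters: v' v u a a' n
  (((lsRel_isCode.subst (n' := 6) ![5, 2, 1, 3]).and ((lsRel_isCode.subst ![5, 1, 0, 4]).and
    ((lsRel_link h k).subst ![2, 1, 0]))).ex.ex.ex :)

theorem lsRel_along (h : LSRel 2 fun w a => A w (a 0) (a 1)) (k : ℕ) :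
    LSRel 3 fun w a => Along w.length (A w) k (a 0) (a 1) (a 2) := by
  have hp := (lsRel_codeLink h k).pow
  -- counters: j b a y' x' n x y
  exact (lsRel_eq.subst ![1, 2]).or
    ((lsRel_isCode.subst (n' := 8) ![5, 6, 4, 2]).and ((h.subst ![6, 4]).and
      ((lsRel_isCode.subst ![5, 3, 7, 1]).and ((h.subst ![3, 7]).and
        (hp.subst ![0, 2, 1, 5]))))).ex.ex.ex.ex.ex

/-- The exponent `j` is a constant, so the intermediate vertices can be kept in finitely many
counters. By contrast, the length of a chain is unbounded and is handled by `LSRel.pow`. -/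
theorem lsRel_alongPow (h : LSRel 2 fun w a => A w (a 0) (a 1)) (k j : ℕ) :
    LSRel 3 fun w a => AlongPow w.length (A w) k (a 0) j (a 1) (a 2) := by
  induction j with
  | zero => exact lsRel_eq.subst ![1, 2]
  | succ j ih => exact (((lsRel_along h k).subst (n' := 4) ![1, 2, 0]).and
      (ih.subst ![1, 0, 3])).ex

end

theorem lsRel_accepted (k : ℕ) : LSRel 0 fun w _ => Accepted k w :=
  -- counters: b t s n
  ((lsRel_isHeader.subst (n' := 4) ![3, 2, 1, 0]).and
    ((lsRel_alongPow lsRel_inputAdj k k).subst ![3, 2, 1])).ex.ex.ex.ex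

theorem inLogspace_accepted (k : ℕ) : InLogspace {w | Accepted k w} :=
  LS.inLogspace (lsRel_accepted k 1 Fin.elim0 one_pos fun i => i.elim0)

/-! ### Correctness of the linking -/

open Relation

/-- The counting function grows by at most one per step, and only at elements satisfying `p`. -/
theorem exists_count_eq {p : ℕ → Prop} [DecidablePred p] {j u : ℕ} (h : j < Nat.count p u) :
    ∃ u' < u, p u' ∧ Nat.count p u' = j := by
  induction u with
  | zero => simp at h
  | succ u ih =>
    rw [Nat.count_succ] at h
    by_cases hj : j < Nat.count p u
    · obtain ⟨u', hu, hp⟩ := ih hj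
      exact ⟨u', hu.trans (Nat.lt_succ_self u), hp⟩
    · split_ifs at h with hp
      · exact ⟨u, Nat.lt_succ_self u, hp, by omega⟩
      · omega

theorem rankGE_iff (p : ℕ → Prop) [DecidablePred p] {j u : ℕ} :
    RankGE p j u ↔ j ≤ Nat.count p u := by
  induction j generalizing u with
  | zero => simp [RankGE]
  | succ j ih =>
    simp only [RankGE, ih]
    constructor
    · rintro ⟨u', hu, hp, hj⟩
      exact lt_of_le_of_lt hj (Nat.count_strict_mono hp hu)
    · intro h
      obtain ⟨u', hu, hp, hj⟩ := exists_count_eq (Nat.lt_of_succ_le h)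
      exact ⟨u', hu, hp, hj.ge⟩

open Classical in
/-- An acyclic digraph on `{0, …, n - 1}` with degrees and total excess at most `k`. -/
structure BoundedExcess (A : ℕ → ℕ → Prop) (n k : ℕ) : Prop where
  lt : ∀ {u v}, A u v → u < n ∧ v < n
  acyclic : ∀ v, ¬ TransGen A v v
  in_le : ∀ v, Nat.count (fun u => A u v) n ≤ k
  out_le : ∀ v, Nat.count (A v) n ≤ k
  excess_le : ∑ v ∈ Finset.range n, (Nat.count (A v) n - Nat.count (fun u => A u v) n) ≤ k

/-- `Link`, as a relation on arcs. -/
def ArcLink (A : ℕ → ℕ → Prop) (k : ℕ) (e e' : ℕ × ℕ) : Prop :=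
  e'.1 = e.2 ∧ Link A k e.1 e.2 e'.2

namespace BoundedExcess

variable {A : ℕ → ℕ → Prop} {n k N : ℕ}

open Classical in
-- Both ranks are below `k` by the degree bounds, so agreement of the thresholds up to `k` forces
-- equality.
theorem link_iff (h : BoundedExcess A n k) {u v v' : ℕ} (hu : A u v) (hv : A v v') :
    Link A k u v v' ↔ Nat.count (fun u => A u v) u = Nat.count (A v) v' := by
  have h1 : Nat.count (fun u => A u v) u < k :=
    (Nat.count_strict_mono (p := fun u => A u v) hu (h.lt hu).1).trans_le (h.in_le v)
  have h2 : Nat.count (A v) v' < k :=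
    (Nat.count_strict_mono hv (h.lt hv).2).trans_le (h.out_le v)
  simp only [Link, hu, hv, true_and, rankGE_iff]
  refine ⟨fun hj => le_antisymm ((hj _ h1.le).1 le_rfl) ((hj _ h2.le).2 le_rfl), fun he j _ => ?_⟩
  rw [he]

/-- An arc out of a given vertex is determined by its rank. -/
theorem arcLink_unique (h : BoundedExcess A n k) {e e₁ e₂ : ℕ × ℕ} (h₁ : ArcLink A k e e₁)
    (h₂ : ArcLink A k e e₂) : e₁ = e₂ := by
  classical
  have h1 := (h.link_iff h₁.2.1 h₁.2.2.1).1 h₁.2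
  have h2 := (h.link_iff h₂.2.1 h₂.2.2.1).1 h₂.2
  exact Prod.ext (h₁.1.trans h₂.1.symm)
    (Nat.count_injective h₁.2.2.1 h₂.2.2.1 (h1.symm.trans h2))

open Classical in
/-- The number of vertices after `u`. -/
noncomputable def height (A : ℕ → ℕ → Prop) (n u : ℕ) : ℕ :=
  ((Finset.range n).filter (TransGen A u)).card

theorem height_lt (h : BoundedExcess A n k) {u v : ℕ} (huv : A u v) :
    height A n v < height A n u := by
  classical
  refine Finset.card_lt_card ⟨fun x hx => ?_, fun hs => ?_⟩
  · simp only [Finset.mem_filter] at hx ⊢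
    exact ⟨hx.1, TransGen.head huv hx.2⟩
  · have := hs (show v ∈ _ by simpa using ⟨(h.lt huv).2, TransGen.single huv⟩)
    exact h.acyclic v (by simpa using (Finset.mem_filter.1 this).2)

theorem height_le (A : ℕ → ℕ → Prop) (n u : ℕ) : height A n u ≤ n := by
  classical
  exact (Finset.card_filter_le _ _).trans (Finset.card_range n).le

open Classical in
/-- The arcs which do not follow another arc. -/
noncomputable def roots (A : ℕ → ℕ → Prop) (n : ℕ) : Finset (ℕ × ℕ) :=
  (Finset.range n ×ˢ Finset.range n).filter fun e =>
    A e.1 e.2 ∧ Nat.count (fun u => A u e.1) n ≤ Nat.count (A e.1) e.2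

/-- The roots leaving `v` are the outgoing arcs whose rank is at least the indegree. Their ranks are
distinct elements of the interval from the indegree to the outdegree, so there are at most as many
as the excess of `v`. -/
theorem card_roots_le (h : BoundedExcess A n k) : (roots A n).card ≤ k := by
  classical
  refine le_trans ?_ h.excess_le
  rw [Finset.card_eq_sum_card_fiberwise (f := Prod.fst) (t := Finset.range n)]
  · refine Finset.sum_le_sum fun v _ => ?_
    rw [← Nat.card_Ico]
    refine Finset.card_le_card_of_injOn (fun e => Nat.count (A v) e.2) ?_ ?_
    · intro e he
      simp only [roots, Finset.coe_filter, Finset.mem_filter, Set.mem_ofPred_eq] at he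
      obtain ⟨⟨-, hA, hc⟩, rfl⟩ := he
      simp only [Finset.coe_Ico, Set.mem_Ico]
      exact ⟨hc, Nat.count_strict_mono hA (h.lt hA).2⟩
    · intro e he e' he' heq
      simp only [roots, Finset.coe_filter, Finset.mem_filter, Set.mem_ofPred_eq] at he he'
      obtain ⟨⟨-, hA, -⟩, rfl⟩ := he
      obtain ⟨⟨-, hA', -⟩, hv⟩ := he'
      rw [hv] at hA'
      exact Prod.ext hv.symm (Nat.count_injective hA hA' heq)
  · intro e he
    simp only [roots, Finset.coe_filter, Set.mem_ofPred_eq, Finset.mem_product] at he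
    exact he.1.1

/-- An arc that is not a root has rank below the indegree of its source, so some incoming arc has
the same rank. Going back this way increases `height`, which is at most `n`. -/
theorem exists_root (h : BoundedExcess A n k) {u v : ℕ} (huv : A u v) :
    ∃ r ∈ roots A n, ReflTransGen (ArcLink A k) r (u, v) := by
  classical
  induction hm : n - height A n u using Nat.strong_induction_on generalizing u v with
  | _ m ih =>
    by_cases hr : (u, v) ∈ roots A n
    · exact ⟨_, hr, .refl⟩
    · have hlt : Nat.count (A u) v < Nat.count (fun x => A x u) n := by
        by_contra hle
        refine hr ?_
        simp only [roots, Finset.mem_filter, Finset.mem_product, Finset.mem_range]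
        exact ⟨h.lt huv, huv, not_lt.1 hle⟩
      obtain ⟨u', -, hA, hc⟩ := exists_count_eq hlt
      have h1 := h.height_lt hA
      have h2 := height_le A n u'
      obtain ⟨r, hr, hrl⟩ := ih _ (by omega) hA rfl
      exact ⟨r, hr, hrl.tail ⟨rfl, (h.link_iff hA huv).2 hc⟩⟩

/-! ### Codes of arcs -/

theorem isCode_iff {u v a : ℕ} (ha : a ≤ N) : IsCode N n u v a ↔ u * n + v = a :=
  ⟨fun ⟨_, _, h, h'⟩ => h ▸ h', fun h => ⟨_, by omega, rfl, h⟩⟩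

theorem code_le (hN : n * n ≤ N) {u v : ℕ} (hu : u < n) (hv : v < n) : u * n + v ≤ N := by
  have : (u + 1) * n ≤ n * n := Nat.mul_le_mul_right n hu
  rw [Nat.succ_mul] at this
  omega

theorem code_injective {u v u' v' : ℕ} (hv : v < n) (hv' : v' < n)
    (he : u * n + v = u' * n + v') : u = u' ∧ v = v' := by
  have h1 := congrArg (· / n) he
  have h2 := congrArg (· % n) he
  have hn : 0 < n := by omega
  simp only [Nat.mul_comm _ n, Nat.mul_add_div hn, Nat.mul_add_mod, Nat.div_eq_of_lt hv,
    Nat.div_eq_of_lt hv', Nat.mod_eq_of_lt hv, Nat.mod_eq_of_lt hv'] at h1 h2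
  exact ⟨by simpa using h1, h2⟩

/-- Arcs are coded as single numbers because `LeastPow` iterates relations between numbers; `n * n ≤
N` makes all codes fit. -/
theorem codeLink_iff (h : BoundedExcess A n k) (hN : n * n ≤ N) {u v c : ℕ} (huv : A u v) :
    CodeLink N A k n (u * n + v) c ↔ ∃ v', Link A k u v v' ∧ c = v * n + v' := by
  have hnN : n ≤ N := (Nat.le_mul_self n).trans hN
  have hlt := h.lt huv
  constructor
  · rintro ⟨u', -, v', -, v'', -, ⟨_, -, rfl, h1⟩, ⟨_, -, rfl, h2⟩, hl⟩
    obtain ⟨rfl, rfl⟩ := code_injective (h.lt hl.1).2 hlt.2 h1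
    exact ⟨v'', hl, h2.symm⟩
  · rintro ⟨v', hl, rfl⟩
    have hlt' := h.lt hl.2.1
    exact ⟨u, by omega, v, by omega, v', by omega, (isCode_iff (code_le hN hlt.1 hlt.2)).2 rfl,
      (isCode_iff (code_le hN hlt'.1 hlt'.2)).2 rfl, hl⟩

/-- Successor arcs are unique, so asking for the least code is no restriction. -/
theorem leastRel_codeLink_iff (h : BoundedExcess A n k) (hN : n * n ≤ N) {u v c : ℕ}
    (huv : A u v) :
    LeastRel (CodeLink N A k n) (u * n + v) c ↔ ∃ v', Link A k u v v' ∧ c = v * n + v' := by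
  constructor
  · exact fun hc => (h.codeLink_iff hN huv).1 hc.1
  · intro hc
    refine (LeastRel.iff_of_unique fun c' hc' => ?_).2 ((h.codeLink_iff hN huv).2 hc)
    obtain ⟨v₁, h₁, rfl⟩ := hc
    obtain ⟨v₂, h₂, rfl⟩ := (h.codeLink_iff hN huv).1 hc'
    have : ((v, v₁) : ℕ × ℕ) = (v, v₂) := h.arcLink_unique (e := (u, v)) ⟨rfl, h₁⟩ ⟨rfl, h₂⟩
    have h₃ : v₁ = v₂ := (Prod.ext_iff.1 this).2
    rw [h₃]

/-- Each link lowers the height of the source. The resulting bound on `j` is needed because `Along`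
only allows `j ≤ N`. -/
theorem leastPow_of_arcLink (h : BoundedExcess A n k) (hN : n * n ≤ N) {e e' : ℕ × ℕ}
    (hl : ReflTransGen (ArcLink A k) e e') : ∃ j ≤ height A n e.1,
      LeastPow N (CodeLink N A k n) j (e.1 * n + e.2) (e'.1 * n + e'.2) := by
  induction hl using ReflTransGen.head_induction_on with
  | refl => exact ⟨0, Nat.zero_le _, rfl⟩
  | @head e e₁ h1 _ ih =>
    obtain ⟨j, hj, hp⟩ := ih
    obtain ⟨u, v⟩ := e
    obtain ⟨v₀, v₁⟩ := e₁
    obtain ⟨rfl, hl⟩ := h1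
    have hlt := h.lt hl.2.1
    exact ⟨j + 1, hj.trans_lt (h.height_lt hl.1), _, code_le hN hlt.1 hlt.2,
      (h.leastRel_codeLink_iff hN hl.1).2 ⟨v₁, hl, rfl⟩, hp⟩

theorem reflTransGen_of_leastPow (h : BoundedExcess A n k) (hN : n * n ≤ N) {j u v a b : ℕ}
    (huv : A u v) (hab : A a b)
    (hp : LeastPow N (CodeLink N A k n) j (u * n + v) (a * n + b)) : ReflTransGen A v b := by
  induction j generalizing u v with
  | zero =>
    obtain ⟨-, rfl⟩ := code_injective (h.lt huv).2 (h.lt hab).2 hp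
    exact .refl
  | succ j ih =>
    obtain ⟨c, -, hc, hp⟩ := hp
    obtain ⟨v', hl, rfl⟩ := (h.leastRel_codeLink_iff hN huv).1 hc
    exact .head hl.2.1 (ih hl.2.1 hp)

theorem reflTransGen_of_along (h : BoundedExcess A n k) (hN : n * n ≤ N) {x y : ℕ}
    (hxy : Along N A k n x y) : ReflTransGen A x y := by
  obtain rfl | ⟨x', -, y', -, a, ha, b, hb, j, -, hxa, hx, hyb, hy, hp⟩ := hxy
  · exact .refl
  · rw [isCode_iff ha] at hxa
    rw [isCode_iff hb] at hyb
    subst hxa hyb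
    exact .head hx (h.reflTransGen_of_leastPow hN hx hy hp)

theorem reflTransGen_of_alongPow (h : BoundedExcess A n k) (hN : n * n ≤ N) {j x y : ℕ}
    (hxy : AlongPow N A k n j x y) : ReflTransGen A x y := by
  induction j generalizing x with
  | zero =>
    obtain rfl := hxy
    exact .refl
  | succ j ih =>
    obtain ⟨z, -, hz, hp⟩ := hxy
    exact (h.reflTransGen_of_along hN hz).trans (ih hp)

theorem along_of_arcLink (h : BoundedExcess A n k) (hN : n * n ≤ N) {x x' y' y : ℕ} (hx : A x x')
    (hy : A y' y) (hl : ReflTransGen (ArcLink A k) (x, x') (y', y)) : Along N A k n x y := by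
  obtain ⟨j, hj, hp⟩ := h.leastPow_of_arcLink hN hl
  have hnN : n ≤ N := (Nat.le_mul_self n).trans hN
  have hjn := hj.trans (height_le A n x)
  have hxn := h.lt hx
  have hyn := h.lt hy
  have ha := code_le hN hxn.1 hxn.2
  have hb := code_le hN hyn.1 hyn.2
  exact .inr ⟨x', by omega, y', by omega, _, ha, _, hb, j, by omega, (isCode_iff ha).2 rfl, hx,
    (isCode_iff hb).2 rfl, hy, hp⟩

theorem reflTransGen_of_arcLink {e e' : ℕ × ℕ} (hl : ReflTransGen (ArcLink A k) e e') :
    e = e' ∨ ReflTransGen A e.2 e'.1 := by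
  induction hl with
  | refl => exact .inl rfl
  | @tail e₁ e₂ _ h1 ih =>
    obtain ⟨h1, h2⟩ := h1
    rw [h1]
    rcases ih with rfl | ih
    · exact .inr .refl
    · exact .inr (ih.tail h2.1)

/-! ### Covering a walk by few chains -/

theorem alongPow_succ (hN : n ≤ N) {j x y : ℕ} (hx : x < n) (h : AlongPow N A k n j x y) :
    AlongPow N A k n (j + 1) x y :=
  ⟨x, by omega, .inl rfl, h⟩

theorem alongPow_mono (hN : n ≤ N) {j j' x y : ℕ} (hj : j ≤ j') (hx : x < n)
    (h : AlongPow N A k n j x y) : AlongPow N A k n j' x y := by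
  induction hj with
  | refl => exact h
  | step _ ih => exact alongPow_succ hN hx ih

/-- The arcs lying on a path with root in `U`. -/
def ArcFrom (A : ℕ → ℕ → Prop) (k : ℕ) (U : Finset (ℕ × ℕ)) (u v : ℕ) : Prop :=
  A u v ∧ ∃ r ∈ U, ReflTransGen (ArcLink A k) r (u, v)

/-- The walk is cut after the last arc `(a, b)` for which `r` was the chosen root; every later arc
has another root in `U`. -/
theorem arcFrom_split {U : Finset (ℕ × ℕ)} {x y : ℕ} (r : ℕ × ℕ)
    (hxy : ReflTransGen (ArcFrom A k U) x y) :
    ReflTransGen (ArcFrom A k (U.erase r)) x y ∨ ∃ a b, ReflTransGen A x a ∧ A a b ∧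
      ReflTransGen (ArcLink A k) r (a, b) ∧ ReflTransGen (ArcFrom A k (U.erase r)) b y := by
  induction hxy using ReflTransGen.head_induction_on with
  | refl => exact .inl .refl
  | @head x x₁ h1 _ ih =>
    rcases ih with ih | ⟨a, b, ha, hab, hr, hb⟩
    · obtain ⟨hA, r', hr', hl⟩ := h1
      by_cases he : r' = r
      · subst he
        exact .inr ⟨x, x₁, .refl, hA, hl, ih⟩
      · exact .inl (.head ⟨hA, r', Finset.mem_erase.2 ⟨he, hr'⟩, hl⟩ ih)
    · exact .inr ⟨a, b, .head h1.1 ha, hab, hr, hb⟩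

/-- Each jump uses up one root: it goes along the chain of the first arc to the arc given by
`arcFrom_split`, after which that root is no longer needed. -/
theorem alongPow_of_arcFrom (h : BoundedExcess A n k) (hN : n * n ≤ N) (U : Finset (ℕ × ℕ))
    {x y : ℕ} (hx : x < n) (hxy : ReflTransGen (ArcFrom A k U) x y) :
    AlongPow N A k n U.card x y := by
  have hnN : n ≤ N := (Nat.le_mul_self n).trans hN
  induction hU : U.card generalizing U x with
  | zero =>
    rcases hxy.cases_head with he | ⟨x₁, ⟨-, r, hr, -⟩, -⟩
    · exact he
    · rw [Finset.card_eq_zero.1 hU] at hr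
      simp at hr
  | succ m ih =>
    rcases hxy.cases_head with rfl | ⟨x₁, ⟨hA, r, hr, hl⟩, -⟩
    -- `AlongPow` has an exact number of segments, so the surplus ones stay at the vertex.
    · obtain ⟨r, hr⟩ := Finset.card_pos.1 (show 0 < U.card by omega)
      exact alongPow_succ hnN hx (ih (U.erase r) hx .refl (by
        rw [Finset.card_erase_of_mem hr, hU]; rfl))
    · have hcard : (U.erase r).card = m := by rw [Finset.card_erase_of_mem hr, hU]; rfl
      rcases arcFrom_split r hxy with hxy' | ⟨a, b, hxa, hab, hr', hby⟩
      · exact alongPow_succ hnN hx (ih _ hx hxy' hcard)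
      · have hbn := (h.lt hab).2
        refine ⟨b, by omega, h.along_of_arcLink hN hA hab ?_, ih _ hbn hby hcard⟩
        have hu : Relator.RightUnique (ArcLink A k) := fun _ _ _ h₁ h₂ => h.arcLink_unique h₁ h₂
        -- Both arcs come after `r` on one deterministic chain, so they are comparable. If `(a, b)`
        -- came strictly before the first arc, then `b` would reach `x`, which closes a cycle
        -- through `x`.
        rcases ReflTransGen.total_of_right_unique hu hl hr' with h1 | h1
        · exact h1
        · rcases reflTransGen_of_arcLink h1 with h2 | h2
          · rw [h2]
          · exact absurd (TransGen.tail' hxa hab |>.trans_left h2) (h.acyclic x)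

theorem alongPow_iff (h : BoundedExcess A n k) (hN : n * n ≤ N) {x y : ℕ} (hx : x < n) :
    AlongPow N A k n k x y ↔ ReflTransGen A x y := by
  refine ⟨h.reflTransGen_of_alongPow hN, fun hxy => ?_⟩
  refine alongPow_mono ((Nat.le_mul_self n).trans hN) h.card_roots_le hx
    (h.alongPow_of_arcFrom hN _ hx (ReflTransGen.mono
      (fun _ _ huv => ⟨huv, h.exists_root huv⟩) _ _ hxy))

end BoundedExcess

open Relation

/-! ### Path decompositions bound the degrees and the excess -/

theorem arcOn_iff {V : Type*} {u v : V} {p : List V} :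
    ArcOn u v p ↔ ∃ i, p[i]? = some u ∧ p[i + 1]? = some v := by
  constructor
  · rintro ⟨l, r, rfl⟩
    exact ⟨l.length, by simp, by simp⟩
  · rintro ⟨i, hu, hv⟩
    obtain ⟨hi, rfl⟩ := List.getElem?_eq_some_iff.1 hu
    obtain ⟨hi', rfl⟩ := List.getElem?_eq_some_iff.1 hv
    refine ⟨p.take i, p.drop (i + 2), ?_⟩
    conv_rhs => rw [← List.take_append_drop i p, List.drop_eq_getElem_cons hi,
      List.drop_eq_getElem_cons hi']
    simp

namespace Digraph

variable {V : Type*} {G : Digraph V} {p : List V} {u v v' : V}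

theorem IsSimplePath.index_unique (h : G.IsSimplePath p) {i j : ℕ} (hi : p[i]? = some v)
    (hj : p[j]? = some v) : i = j := by
  obtain ⟨hi', -⟩ := List.getElem?_eq_some_iff.1 hi
  exact (List.getElem?_inj hi' h.nodup).1 (hi.trans hj.symm)

theorem IsSimplePath.target_unique (h : G.IsSimplePath p) (hv : ArcOn u v p)
    (hv' : ArcOn u v' p) : v = v' := by
  obtain ⟨i, hi, hi'⟩ := arcOn_iff.1 hv
  obtain ⟨j, hj, hj'⟩ := arcOn_iff.1 hv'
  obtain rfl := h.index_unique hi hj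
  exact Option.some_injective _ (hi'.symm.trans hj')

theorem IsSimplePath.source_unique (h : G.IsSimplePath p) (hv : ArcOn v u p)
    (hv' : ArcOn v' u p) : v = v' := by
  obtain ⟨i, hi, hi'⟩ := arcOn_iff.1 hv
  obtain ⟨j, hj, hj'⟩ := arcOn_iff.1 hv'
  obtain rfl : i = j := Nat.succ_injective (h.index_unique hi' hj')
  exact Option.some_injective _ (hi.symm.trans hj)

theorem IsSimplePath.adj (h : G.IsSimplePath p) (hv : ArcOn u v p) : G.Adj u v := by
  obtain ⟨i, hi, hi'⟩ := arcOn_iff.1 hv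
  obtain ⟨h1, rfl⟩ := List.getElem?_eq_some_iff.1 hi
  obtain ⟨h2, rfl⟩ := List.getElem?_eq_some_iff.1 hi'
  exact List.isChain_iff_getElem.1 h.isChain i h2

open Classical in
/-- The paths leaving `v`. -/
noncomputable def leaving {k : ℕ} (P : Fin k → List V) (v : V) : Finset (Fin k) :=
  Finset.univ.filter fun i => ∃ b, ArcOn v b (P i)

open Classical in
/-- The paths entering `v`. -/
noncomputable def entering {k : ℕ} (P : Fin k → List V) (v : V) : Finset (Fin k) :=
  Finset.univ.filter fun i => ∃ a, ArcOn a v (P i)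

theorem mem_leaving {k : ℕ} {P : Fin k → List V} {i : Fin k} :
    i ∈ leaving P v ↔ ∃ b, ArcOn v b (P i) := by
  simp [leaving]

theorem mem_entering {k : ℕ} {P : Fin k → List V} {i : Fin k} :
    i ∈ entering P v ↔ ∃ a, ArcOn a v (P i) := by
  simp [entering]

namespace IsPathDecomposition

variable {k : ℕ} {P : Fin k → List V}

open Classical in
-- A simple path contains at most one arc out of `v`, so distinct arcs out of `v` lie on distinct
-- paths.
theorem card_out_le [Fintype V] (h : G.IsPathDecomposition P) (v : V) :
    (Finset.univ.filter fun b => G.Adj v b).card ≤ (leaving P v).card := by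
  refine Finset.card_le_card_of_forall_subsingleton (fun b i => ArcOn v b (P i)) (fun b hb => ?_)
    fun i _ b hb b' hb' => (h.isSimplePath i).target_unique hb.2 hb'.2
  obtain ⟨i, hi, -⟩ := h.existsUnique_arcOn v b (Finset.mem_filter.1 hb).2
  exact ⟨i, mem_leaving.2 ⟨b, hi⟩, hi⟩

open Classical in
theorem card_in_le [Fintype V] (h : G.IsPathDecomposition P) (v : V) :
    (Finset.univ.filter fun a => G.Adj a v).card ≤ (entering P v).card := by
  refine Finset.card_le_card_of_forall_subsingleton (fun a i => ArcOn a v (P i)) (fun a ha => ?_)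
    fun i _ a ha a' ha' => (h.isSimplePath i).source_unique ha.2 ha'.2
  obtain ⟨i, hi, -⟩ := h.existsUnique_arcOn a v (Finset.mem_filter.1 ha).2
  exact ⟨i, mem_entering.2 ⟨a, hi⟩, hi⟩

open Classical in
-- This direction uses that no arc lies on two paths.
theorem card_entering_le [Fintype V] (h : G.IsPathDecomposition P) (v : V) :
    (entering P v).card ≤ (Finset.univ.filter fun a => G.Adj a v).card := by
  refine Finset.card_le_card_of_forall_subsingleton (fun i a => ArcOn a v (P i)) (fun i hi => ?_)
    fun a ha i hi i' hi' =>
      (h.existsUnique_arcOn a v (Finset.mem_filter.1 ha).2).unique hi.2 hi'.2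
  obtain ⟨a, ha⟩ := mem_entering.1 hi
  exact ⟨a, Finset.mem_filter.2 ⟨Finset.mem_univ _, (h.isSimplePath i).adj ha⟩, ha⟩

open Classical in
-- The excess of `v` is at most the number of paths that leave `v` without entering it. Such a path
-- starts at `v`, and each of the `k` paths has only one first vertex.
theorem sum_excess_le [Fintype V] (h : G.IsPathDecomposition P) :
    ∑ v, ((Finset.univ.filter fun b => G.Adj v b).card -
      (Finset.univ.filter fun a => G.Adj a v).card) ≤ k := by
  have hk := Finset.card_eq_sum_card_fiberwise
    (f := fun i => (P i).head (h.isSimplePath i).ne_nil) (s := Finset.univ) (t := Finset.univ)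
    (fun _ _ => Finset.mem_coe.2 (Finset.mem_univ _))
  rw [Finset.card_univ, Fintype.card_fin] at hk
  refine (Finset.sum_le_sum fun v _ => ?_).trans hk.ge
  have h1 := h.card_out_le v
  have h2 := h.card_entering_le v
  have h3 := Finset.le_card_sdiff (entering P v) (leaving P v)
  refine le_trans (by omega) (h3.trans (Finset.card_le_card fun i hi => ?_))
  rw [Finset.mem_sdiff] at hi
  obtain ⟨b, hb⟩ := mem_leaving.1 hi.1
  obtain ⟨j, hj, hj'⟩ := arcOn_iff.1 hb
  refine Finset.mem_filter.2 ⟨Finset.mem_univ _, ?_⟩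
  rcases j with _ | j
  · rw [← List.head?_eq_getElem?, List.head?_eq_some_head (h.isSimplePath i).ne_nil] at hj
    exact Option.some_injective _ hj
  · obtain ⟨hl, -⟩ := List.getElem?_eq_some_iff.1 hj
    exact absurd (mem_entering.2 ⟨_, arcOn_iff.2
      ⟨j, List.getElem?_eq_getElem (by omega), hj⟩⟩) hi.2

end IsPathDecomposition

end Digraph

/-! ### Reading the input -/

theorem IsNextZero.unique {w : List Bool} {p q q' : ℕ} (h : IsNextZero w p q)
    (h' : IsNextZero w p q') (hq : q ≤ w.length) (hq' : q' ≤ w.length) : q = q' := by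
  rcases lt_trichotomy q q' with hlt | he | hlt
  · exact absurd (h'.2.2 q hq ⟨h.1, hlt⟩) h.2.1
  · exact he
  · exact absurd (h.2.2 q' hq' ⟨h'.1, hlt⟩) h'.2.1

theorem isNextZero_append (l r : List Bool) (m : ℕ) :
    IsNextZero (l ++ (List.replicate m true ++ false :: r)) l.length (l.length + m) := by
  refine ⟨Nat.le_add_right _ _, ?_, fun i _ hi => ?_⟩
  · simp
  · rw [List.getElem?_append_right hi.1, List.getElem?_append_left (by simp; omega),
      List.getElem?_replicate_of_lt (by omega)]

theorem getElem?_flatMap_mul {α β : Type*} {f : α → List β} {n : ℕ} (hf : ∀ a, (f a).length = n)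
    (l : List α) {i j : ℕ} (hj : j < n) :
    (l.flatMap f)[i * n + j]? = (l[i]?).bind fun a => (f a)[j]? := by
  induction l generalizing i with
  | nil => simp
  | cons a l ih =>
    rcases i with _ | i
    · rw [List.flatMap_cons, List.getElem?_append_left (by rw [hf]; omega)]
      simp
    · rw [List.flatMap_cons, List.getElem?_append_right (by rw [hf, Nat.succ_mul]; omega), hf,
        show (i + 1) * n + j - n = i * n + j by rw [Nat.succ_mul]; omega, ih]
      simp

section encode

variable {n : ℕ} (G : Digraph (Fin n)) (s t : Fin n)

open Classical in
/-- The adjacency matrix, row by row. -/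
noncomputable def adjMatrixBits : List Bool :=
  (List.finRange n).flatMap fun u => (List.finRange n).map fun v => decide (G.Adj u v)

theorem length_adjMatrixBits : (adjMatrixBits G).length = n * n := by
  simp [adjMatrixBits, List.length_flatMap]

theorem adjMatrixBits_getElem? (u v : Fin n) :
    (adjMatrixBits G)[(u : ℕ) * n + v]? = some true ↔ G.Adj u v := by
  classical
  rw [adjMatrixBits, getElem?_flatMap_mul (n := n) (by simp) _ v.2]
  simp

theorem encodeInstance_eq : encodeInstance G s t =
    (List.replicate n true ++ false :: (List.replicate (s : ℕ) true ++ false ::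
      (List.replicate (t : ℕ) true ++ [false]))) ++ adjMatrixBits G := by
  simp [encodeInstance, adjMatrixBits]

theorem length_encodeInstance : (encodeInstance G s t).length = n + s + t + 3 + n * n := by
  rw [encodeInstance_eq, List.length_append, length_adjMatrixBits]
  simp
  omega

theorem encodeInstance_getElem? (u v : Fin n) :
    (encodeInstance G s t)[n + s + t + 3 + (u : ℕ) * n + v]? = some true ↔ G.Adj u v := by
  rw [← adjMatrixBits_getElem?, encodeInstance_eq, List.getElem?_append_right (by simp; omega)]
  have : n + s + t + 3 + (u : ℕ) * n + v - (List.replicate n true ++ false ::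
    (List.replicate (s : ℕ) true ++ false :: (List.replicate (t : ℕ) true ++ [false]))).length =
      u * n + v := by
    simp
    omega
  rw [this]

theorem isNextZero_encodeInstance : IsNextZero (encodeInstance G s t) 0 n ∧
    IsNextZero (encodeInstance G s t) (n + 1) (n + 1 + s) ∧
      IsNextZero (encodeInstance G s t) (n + 1 + s + 1) (n + 1 + s + 1 + t) := by
  refine ⟨?_, ?_, ?_⟩
  · simpa [encodeInstance_eq] using isNextZero_append [] (List.replicate (s : ℕ) true ++ false ::
      (List.replicate (t : ℕ) true ++ false :: adjMatrixBits G)) n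
  · simpa [encodeInstance_eq] using isNextZero_append (List.replicate n true ++ [false])
      (List.replicate (t : ℕ) true ++ false :: adjMatrixBits G) s
  · simpa [encodeInstance_eq, Nat.add_assoc, Nat.add_comm, Nat.add_left_comm] using
      isNextZero_append (List.replicate n true ++ false ::
        (List.replicate (s : ℕ) true ++ [false])) (adjMatrixBits G) t

theorem isHeader_encodeInstance_iff {n' s' t' b : ℕ} (hn : n' ≤ (encodeInstance G s t).length) :
    IsHeader (encodeInstance G s t) n' s' t' b ↔
      n' = n ∧ s' = s ∧ t' = t ∧ b = n + s + t + 3 := by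
  obtain ⟨h1, h2, h3⟩ := isNextZero_encodeInstance G s t
  have hl := length_encodeInstance G s t
  constructor
  · rintro ⟨o, -, ho, z1, _, -, rfl, p₂, hp₂, z2, h, _, -, rfl, p₄, hp₄, z3, h', h''⟩
    -- The header expresses the starting position `0` by `o + o = o`.
    obtain rfl : o = 0 := by omega
    obtain rfl := z1.unique h1 hn (by omega)
    obtain rfl := z2.unique h2 hp₂ (by omega)
    obtain rfl := z3.unique h3 hp₄ (by omega)
    omega
  · rintro ⟨rfl, rfl, rfl, rfl⟩
    exact ⟨0, by omega, rfl, h1, _, by omega, rfl, _, by omega, h2, rfl, _, by omega, rfl, _,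
      by omega, h3, rfl, by omega⟩

/-- The adjacency relation of a digraph on `Fin n`, on the natural numbers. -/
def Digraph.natAdj {n : ℕ} (G : Digraph (Fin n)) (u v : ℕ) : Prop :=
  ∃ (hu : u < n) (hv : v < n), G.Adj ⟨u, hu⟩ ⟨v, hv⟩

theorem inputAdj_encodeInstance : inputAdj (encodeInstance G s t) = G.natAdj := by
  have hl := length_encodeInstance G s t
  ext u v
  constructor
  · rintro ⟨n', hn', s', -, t', -, b, -, hh, hu, hv, _, -, rfl, _, -, rfl, _, -, rfl, hb⟩
    obtain ⟨rfl, rfl, rfl, rfl⟩ := (isHeader_encodeInstance_iff G s t hn').1 hh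
    exact ⟨hu, hv, (encodeInstance_getElem? G s t ⟨u, hu⟩ ⟨v, hv⟩).1 hb⟩
  · rintro ⟨hu, hv, h⟩
    have hc := BoundedExcess.code_le le_rfl hu hv
    exact ⟨n, by omega, s, by omega, t, by omega, _, by omega,
      (isHeader_encodeInstance_iff G s t (by omega)).2 ⟨rfl, rfl, rfl, rfl⟩, hu, hv, _, by omega,
      rfl, _, by omega, rfl, _, by omega, rfl,
      (encodeInstance_getElem? G s t ⟨u, hu⟩ ⟨v, hv⟩).2 h⟩

theorem accepted_encodeInstance_iff (k : ℕ) : Accepted k (encodeInstance G s t) ↔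
    AlongPow (encodeInstance G s t).length G.natAdj k n k s t := by
  have hl := length_encodeInstance G s t
  rw [Accepted, inputAdj_encodeInstance]
  constructor
  · rintro ⟨n', hn', s', -, t', -, b, -, hh, h⟩
    obtain ⟨rfl, rfl, rfl, rfl⟩ := (isHeader_encodeInstance_iff G s t hn').1 hh
    exact h
  · intro h
    exact ⟨n, by omega, s, by omega, t, by omega, _, by omega,
      (isHeader_encodeInstance_iff G s t (by omega)).2 ⟨rfl, rfl, rfl, rfl⟩, h⟩

end encode

/-! ### Conclusion -/

open Classical in
theorem count_eq_card_filter_fin {n : ℕ} {p : ℕ → Prop} {q : Fin n → Prop}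
    (h : ∀ i : Fin n, p i ↔ q i) : Nat.count p n = (Finset.univ.filter q).card := by
  rw [Nat.count_eq_card_filter_range, ← Finset.card_map Fin.valEmbedding]
  congr 1
  ext x
  simp only [Finset.mem_filter, Finset.mem_range, Finset.mem_map, Finset.mem_univ, true_and,
    Fin.valEmbedding_apply]
  constructor
  · rintro ⟨hx, hp⟩
    exact ⟨⟨x, hx⟩, (h _).1 hp, rfl⟩
  · rintro ⟨i, hi, rfl⟩
    exact ⟨i.2, (h i).2 hi⟩

namespace Digraph

variable {n : ℕ} {G : Digraph (Fin n)}

theorem natAdj_val {u v : Fin n} : G.natAdj u v ↔ G.Adj u v :=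
  ⟨fun ⟨_, _, h⟩ => h, fun h => ⟨u.2, v.2, h⟩⟩

theorem reachable_iff_natAdj {s t : Fin n} :
    ReflTransGen G.natAdj s t ↔ G.Reachable s t := by
  constructor
  · intro h
    have key : ∀ y, ReflTransGen G.natAdj s y → ∃ hy : y < n, G.Reachable s ⟨y, hy⟩ := by
      intro y hy
      induction hy with
      | refl => exact ⟨s.2, .refl⟩
      | tail _ hb ih =>
        obtain ⟨_, hy, hb⟩ := hb
        exact ⟨hy, ih.2.tail hb⟩
    exact (key t h).2
  · exact fun h => ReflTransGen.lift (fun i : Fin n => (i : ℕ)) (fun _ _ => natAdj_val.2) _ _ h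

theorem IsAcyclic.natAdj (h : G.IsAcyclic) (v : ℕ) : ¬ TransGen G.natAdj v v := by
  intro hv
  obtain ⟨x, ⟨hv', hx, hvx⟩, hxv⟩ := TransGen.head'_iff.1 hv
  exact h ⟨v, hv'⟩ (TransGen.head' hvx
    ((reachable_iff_natAdj (s := ⟨x, hx⟩) (t := ⟨v, hv'⟩)).1 hxv))

theorem IsAcyclic.boundedExcess (h : G.IsAcyclic) {k : ℕ} (hk : G.pathNumber ≤ k) :
    BoundedExcess G.natAdj n k := by
  classical
  obtain ⟨P, hP⟩ := G.exists_isPathDecomposition_pathNumber fun v hv => h v (.single hv)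
  have hout : ∀ v : Fin n,
      Nat.count (G.natAdj v) n = (Finset.univ.filter fun b => G.Adj v b).card :=
    fun v => count_eq_card_filter_fin fun i => natAdj_val
  have hin : ∀ v : Fin n,
      Nat.count (fun u => G.natAdj u v) n = (Finset.univ.filter fun a => G.Adj a v).card :=
    fun v => count_eq_card_filter_fin fun i => natAdj_val
  have hcard : ∀ s : Finset (Fin G.pathNumber), s.card ≤ k := fun s =>
    (Finset.card_le_univ s).trans (by simpa using hk)
  refine ⟨fun ⟨hu, hv, _⟩ => ⟨hu, hv⟩, h.natAdj, fun v => ?_, fun v => ?_, ?_⟩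
  · by_cases hv : v < n
    -- Only vertices below `n` matter here; numbers from `n` on carry no arcs.
    · convert ((hin ⟨v, hv⟩).le.trans (hP.card_in_le _)).trans (hcard _)
    · rw [Nat.count_eq_card_filter_range, Finset.filter_false_of_mem fun _ _ ⟨_, h, _⟩ => hv h]
      exact Nat.zero_le _
  · by_cases hv : v < n
    · convert ((hout ⟨v, hv⟩).le.trans (hP.card_out_le _)).trans (hcard _)
    · rw [Nat.count_eq_card_filter_range, Finset.filter_false_of_mem fun _ _ ⟨h, _⟩ => hv h]
      exact Nat.zero_le _
  · rw [Finset.sum_range]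
    refine le_trans (le_of_eq ?_) (hP.sum_excess_le.trans hk)
    refine Finset.sum_congr rfl fun v _ => ?_
    rw [← hout, ← hin]

end Digraph

theorem mainTheorem4 (k : ℕ) :
    ∃ A : Language Bool, InLogspace A ∧
      ∀ (n : ℕ) (G : Digraph (Fin n)) (s t : Fin n),
        G.IsAcyclic → G.pathNumber ≤ k →
          (encodeInstance G s t ∈ A ↔ G.Reachable s t) := by
  refine ⟨{w | Accepted k w}, inLogspace_accepted k, fun n G s t hG hk => ?_⟩
  have hl := length_encodeInstance G s t
  -- The encoding contains the `n * n` matrix entries, so its length bounds all codes of arcs.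
  exact (accepted_encodeInstance_iff G s t k).trans
    (((hG.boundedExcess hk).alongPow_iff (by omega) s.2).trans Digraph.reachable_iff_natAdj)
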